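/- Let $N\ge 1$ be an integer. A function $f:G\to\mathbb{C}$ on an open subset $G$ of a Euclidean space is called polyharmonic of order $N$ if it is $2N$ times continuously differentiable and $\Delta^{N}f=0$ on $G$, where $\Delta$ is the Laplace operator; polyharmonic of order $0$ means identically zero. Let $a<b$ be real numbers, let $u:(a,b)\times\mathbb{R}^{d}\to\mathbb{C}$ be polyharmonic of order $N$, and let $t_0\in(a,b)$ be such that $u(t_0,y)=0$ for all $y\in\mathbb{R}^{d}$. Put $c:=\min\{b-t_0,\,t_0-a\}>0$. Then there exists a function $H_{N-1}:(-c,c)\times\mathbb{R}^{d}\to\mathbb{C}$, polyharmonic of order $N-1$ and odd, i.e. $H_{N-1}(-t,y)=-H_{N-1}(t,y)$ for all $t\in(-c,c)$ and $y\in\mathbb{R}^{d}$, such that $$u(t_0+t,y)+u(t_0-t,y)=t\cdot H_{N-1}(t,y)\qquad\text{for all } t\in(-c,c),\ y\in\mathbb{R}^{d}.$$ -/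

import Mathlib

/-- The Euclidean space `ℝ × ℝ^d` (with the Euclidean norm), whose points are written `(t, y)`. -/
abbrev TimeSpace (d : ℕ) : Type := WithLp 2 (ℝ × EuclideanSpace ℝ (Fin d))

/-- The point `(t, y)` of `ℝ × ℝ^d`. -/
abbrev TimeSpace.mk {d : ℕ} (t : ℝ) (y : EuclideanSpace ℝ (Fin d)) : TimeSpace d :=
  WithLp.toLp 2 (t, y)

/-- The strip `(a, b) × ℝ^d`. -/
def strip (d : ℕ) (a b : ℝ) : Set (TimeSpace d) :=
  {x | x.fst ∈ Set.Ioo a b}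

/-- A complex-valued function is polyharmonic of order `N` on an open set `G` if it is `2N` times
continuously differentiable on `G` and the `N`-th iterate of the Laplacian annihilates it on `G`.
(The values of `f` outside the open set `G` are irrelevant, and order `0` means `f = 0` on `G`.) -/
def PolyharmonicOn {E : Type*} [NormedAddCommGroup E] [InnerProductSpace ℝ E]
    [FiniteDimensional ℝ E] (N : ℕ) (f : E → ℂ) (G : Set E) : Prop :=
  ContDiffOn ℝ ((2 * N : ℕ) : WithTop ℕ∞) f G ∧
    ∀ x ∈ G, ((Laplacian.laplacian : (E → ℂ) → (E → ℂ))^[N] f) x = 0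

/-- A function `u` on the strip `(a, b) × ℝ^d` is odd at `t₀ ∈ (a, b)` if
`u (t₀ + t, y) = - u (t₀ - t, y)` for all `|t| < min (b - t₀) (t₀ - a)` and all `y`. -/
def IsOddAt {d : ℕ} (a b t₀ : ℝ) (u : TimeSpace d → ℂ) : Prop :=
  ∀ t : ℝ, |t| < min (b - t₀) (t₀ - a) → ∀ y : EuclideanSpace ℝ (Fin d),
    u (TimeSpace.mk (t₀ + t) y) = -u (TimeSpace.mk (t₀ - t) y)

/-! Put `f (t, y) = u (t₀ + t, y) + u (t₀ - t, y)`. It is polyharmonic of order `N`, even in `t`,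
and zero on `t = 0`, so the quotient `H = f / t` is odd. By the fundamental theorem of calculus `H`
is the average over `s ∈ [0, 1]` of `∂ₜ f (s t, y)`, which also defines it on `t = 0`.

It remains to show that `g = Δ^(N-1) H` vanishes. Since `Δ` commutes with `∂ₜ` and `Δ (t h) = t Δ h
+ 2 ∂ₜ h`, applying `Δ^N` to `f = t H` gives `t Δ g + 2 N ∂ₜ g = 0`. As `g` is odd, it vanishes on
`t = 0`. Differentiating the equation `k + 1` times in `t` and setting `t = 0` leaves `(k + 1) Δ
∂ₜ^k g + 2 N ∂ₜ^(k+2) g = 0`. If `∂ₜ^k g` vanishes on the hyperplane, its tangential second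
derivatives vanish there too, so `Δ ∂ₜ^k g = ∂ₜ^(k+2) g` on it, and the positive factor `k + 1 + 2
N` forces `∂ₜ^(k+2) g = 0`. Thus all normal derivatives of `g` vanish on `t = 0`
(`iterate_dirDeriv_eq_zero`), and analyticity gives `g = 0` along every time line.
`PolyharmonicOn.timeQuotient` assembles this.

Most of the work is analyticity. A finite Pizzetti formula yields a smooth compactly supported
kernel `η` with `f x = ∫ η z • f (x - r z)` for every polyharmonic `f` of the given order.
Derivatives can be moved onto the kernel, which gives bounds `M C^k k!` on the `k`-th derivatives,
hence analyticity. The same bounds survive averaging over contractions, so `H` is analytic across `t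
= 0`. -/

open MeasureTheory Metric Set Filter
open scoped Topology ContDiff Nat

/-! ### Parametric integrals and a criterion for analyticity -/

/-- Differentiation under the integral sign over a compact set. -/
theorem hasFDerivAt_setIntegral_of_isCompact {X Z F : Type*} [NormedAddCommGroup X]
    [NormedSpace ℝ X] [ProperSpace X] [NormedAddCommGroup F] [NormedSpace ℝ F]
    [TopologicalSpace Z] [SecondCountableTopology Z] [T2Space Z] [MeasurableSpace Z]
    [OpensMeasurableSpace Z] {μ : Measure Z} [IsFiniteMeasureOnCompacts μ] {K : Set Z}
    (hK : IsCompact K) {S : Set X} (hS : IsOpen S) {x₀ : X} (hx₀ : x₀ ∈ S) {h : X → Z → F}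
    {h' : X → Z → X →L[ℝ] F} (hc : ∀ x ∈ S, ContinuousOn (h x) K)
    (hc' : ContinuousOn (Function.uncurry h') (S ×ˢ K))
    (hd : ∀ x ∈ S, ∀ z ∈ K, HasFDerivAt (fun x ↦ h x z) (h' x z) x) :
    HasFDerivAt (fun x ↦ ∫ z in K, h x z ∂μ) (∫ z in K, h' x₀ z ∂μ) x₀ := by
  obtain ⟨ε, hε, hεS⟩ := nhds_basis_closedBall.mem_iff.1 (hS.mem_nhds hx₀)
  have hcomp : IsCompact (closedBall x₀ ε ×ˢ K) := (isCompact_closedBall x₀ ε).prod hK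
  obtain ⟨B, hB⟩ := hcomp.exists_bound_of_continuousOn (hc'.mono (prod_mono hεS Subset.rfl))
  have hKm := hK.measurableSet
  refine hasFDerivAt_integral_of_dominated_of_fderiv_le (bound := fun _ ↦ B)
    (closedBall_mem_nhds x₀ hε) ?_ ((hc x₀ hx₀).integrableOn_compact hK) ?_ ?_ ?_ ?_
  · filter_upwards [hS.mem_nhds hx₀] with x hx
    exact (hc x hx).aestronglyMeasurable hKm
  · refine ContinuousOn.aestronglyMeasurable ?_ hKm
    exact hc'.comp (f := fun z ↦ (x₀, z)) (by fun_prop) (fun z hz ↦ ⟨hx₀, hz⟩)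
  · refine (ae_restrict_iff' hKm).2 (ae_of_all _ fun z hz x hx ↦ ?_)
    exact hB (x, z) ⟨hx, hz⟩
  · exact integrableOn_const hK.measure_lt_top.ne
  · exact (ae_restrict_iff' hKm).2 (ae_of_all _ fun z hz x hx ↦ hd x (hεS hx) z hz)

/-- A smooth function whose iterated derivatives grow at most like `M C ^ k k!` is analytic. -/
theorem analyticAt_of_norm_iteratedFDeriv_le {E F : Type*} [NormedAddCommGroup E]
    [NormedSpace ℝ E] [NormedAddCommGroup F] [NormedSpace ℝ F] [CompleteSpace F] {f : E → F}
    {x : E} {M C r : ℝ} (hr : 0 < r) (hC : 0 < C) (hf : ContDiffOn ℝ ∞ f (ball x r))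
    (hb : ∀ k : ℕ, ∀ y ∈ ball x r, ‖iteratedFDeriv ℝ k f y‖ ≤ M * C ^ k * k !) :
    AnalyticAt ℝ f x := by
  have hM : 0 ≤ M := by
    have := (norm_nonneg _).trans (hb 0 x (mem_ball_self hr))
    simpa using this
  -- For `‖y‖ < ρ` the segment from `x` to `x + y` stays in the ball, and the `k`-th Taylor term is
  -- at most `M / 2 ^ k`.
  set ρ : ℝ := min r (1 / (2 * C)) with hρ
  have hρ0 : 0 < ρ := lt_min hr (by positivity)
  have hρC : C * ρ ≤ 1 / 2 := by
    calc C * ρ ≤ C * (1 / (2 * C)) := by gcongr; exact min_le_right _ _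
      _ = 1 / 2 := by field_simp
  let p : FormalMultilinearSeries ℝ E F := fun k ↦ (k ! : ℝ)⁻¹ • iteratedFDeriv ℝ k f x
  have hp : ∀ k, ‖p k‖ ≤ M * C ^ k := by
    intro k
    have hk : (0 : ℝ) < k ! := by positivity
    simp only [p]
    rw [norm_smul, norm_inv, Real.norm_of_nonneg hk.le, inv_mul_le_iff₀ hk, mul_comm]
    exact hb k x (mem_ball_self hr)
  refine ⟨p, ENNReal.ofReal ρ, ?_, by simpa using hρ0, ?_⟩
  · refine p.le_radius_of_bound (r := ρ.toNNReal) M fun k ↦ ?_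
    rw [Real.coe_toNNReal _ hρ0.le]
    calc ‖p k‖ * ρ ^ k ≤ M * C ^ k * ρ ^ k := by gcongr; exact hp k
      _ = M * (C * ρ) ^ k := by rw [mul_pow, mul_assoc]
      _ ≤ M * 1 := by
        gcongr
        exact pow_le_one₀ (by positivity) (hρC.trans (by norm_num))
      _ = M := mul_one M
  · intro y hy
    have hyρ : ‖y‖ < ρ := by
      rw [mem_eball_zero_iff, ← ofReal_norm] at hy
      exact (ENNReal.ofReal_lt_ofReal_iff hρ0).1 hy
    have hyC : C * ‖y‖ ≤ 1 / 2 := le_trans (by gcongr) hρC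
    have hsum : Summable fun k ↦ p k fun _ ↦ y := by
      refine Summable.of_norm_bounded (g := fun k ↦ M * (1 / 2 : ℝ) ^ k)
        ((summable_geometric_of_lt_one (by norm_num) (by norm_num)).mul_left M) fun k ↦ ?_
      calc ‖p k fun _ ↦ y‖ ≤ ‖p k‖ * ‖y‖ ^ k := by
            simpa using (p k).le_opNorm fun _ ↦ y
        _ ≤ M * C ^ k * ‖y‖ ^ k := by gcongr; exact hp k
        _ = M * (C * ‖y‖) ^ k := by rw [mul_pow, mul_assoc]
        _ ≤ M * (1 / 2) ^ k := by gcongr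
    refine hsum.hasSum_iff_tendsto_nat.2 ?_
    rw [← tendsto_add_atTop_iff_nat 1, tendsto_iff_norm_sub_tendsto_zero]
    have hseg : ∀ t ∈ Icc (0 : ℝ) 1, x + t • y ∈ ball x r := by
      intro t ht
      rw [mem_ball, dist_eq_norm, add_sub_cancel_left, norm_smul, Real.norm_of_nonneg ht.1]
      calc t * ‖y‖ ≤ 1 * ‖y‖ := by gcongr; exact ht.2
        _ < r := by rw [one_mul]; exact hyρ.trans_le (min_le_left _ _)
    -- The integral remainder carries `1 / n!` against a derivative of size `(n + 1)!`; the surplus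
    -- factor `n + 1` is beaten by `(1 / 2) ^ (n + 1)`.
    have hlim : Tendsto (fun n : ℕ ↦ M * ((n + 1 : ℕ) * (1 / 2 : ℝ) ^ (n + 1))) atTop (𝓝 0) := by
      have := (tendsto_self_mul_const_pow_of_lt_one (r := (1 / 2 : ℝ)) (by norm_num)
        (by norm_num)).const_mul M
      rw [mul_zero] at this
      exact this.comp (tendsto_add_atTop_nat 1)
    refine squeeze_zero (fun _ ↦ norm_nonneg _) (fun n ↦ ?_) hlim
    have htay := map_add_eq_sum_add_integral_iteratedFDeriv (f := f) (x := x) (y := y) (n := n)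
      fun t ht ↦ ((hf.contDiffAt (isOpen_ball.mem_nhds (hseg t ht))).of_le
        (by exact_mod_cast le_top))
    rw [htay]
    have hpk : ∀ k, (p k fun _ ↦ y) = (k ! : ℝ)⁻¹ • iteratedFDeriv ℝ k f x fun _ ↦ y :=
      fun k ↦ rfl
    simp_rw [hpk]
    rw [sub_add_cancel_left, norm_neg, norm_smul]
    have hint : ‖∫ t in (0 : ℝ)..1,
        (1 - t) ^ n • iteratedFDeriv ℝ (n + 1) f (x + t • y) fun _ ↦ y‖ ≤
        (M * C ^ (n + 1) * (n + 1)! * ‖y‖ ^ (n + 1)) * |1 - 0| := by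
      refine intervalIntegral.norm_integral_le_of_norm_le_const fun t ht ↦ ?_
      rw [uIoc_of_le zero_le_one] at ht
      rw [norm_smul]
      have h1 : ‖(1 - t) ^ n‖ ≤ 1 := by
        rw [norm_pow]
        refine pow_le_one₀ (norm_nonneg _) ?_
        rw [Real.norm_eq_abs, abs_le]
        constructor <;> linarith [ht.1, ht.2]
      have h2 : ‖iteratedFDeriv ℝ (n + 1) f (x + t • y) fun _ ↦ y‖ ≤
          M * C ^ (n + 1) * (n + 1)! * ‖y‖ ^ (n + 1) := by
        refine ((iteratedFDeriv ℝ (n + 1) f (x + t • y)).le_opNorm fun _ ↦ y).trans ?_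
        rw [Finset.prod_const, Finset.card_univ, Fintype.card_fin]
        gcongr
        exact hb (n + 1) _ (hseg t ⟨ht.1.le, ht.2⟩)
      calc _ ≤ 1 * _ := mul_le_mul h1 h2 (norm_nonneg _) zero_le_one
        _ = _ := one_mul _
    rw [sub_zero, abs_one, mul_one] at hint
    have hn : (0 : ℝ) < n ! := by positivity
    rw [norm_inv, Real.norm_of_nonneg hn.le, inv_mul_le_iff₀ hn]
    refine hint.trans ?_
    calc M * C ^ (n + 1) * (n + 1)! * ‖y‖ ^ (n + 1)
        = M * (n ! * ((n + 1 : ℕ) * (C * ‖y‖) ^ (n + 1))) := by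
          rw [Nat.factorial_succ, mul_pow]; push_cast; ring
      _ ≤ M * (n ! * ((n + 1 : ℕ) * (1 / 2) ^ (n + 1))) := by gcongr
      _ = _ := by ring

/-! ### Regularity and locality of the Laplacian -/

section Laplacian

open scoped Laplacian

variable {E F : Type*} [NormedAddCommGroup E] [InnerProductSpace ℝ E] [FiniteDimensional ℝ E]
  [NormedAddCommGroup F] [NormedSpace ℝ F]

theorem laplacian_apply_eq_sum_fderiv {ι : Type*} [Fintype ι] (b : OrthonormalBasis ι ℝ E)
    (f : E → F) (x : E) : Δ f x = ∑ i, fderiv ℝ (fderiv ℝ f) x (b i) (b i) := by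
  simp [InnerProductSpace.laplacian_eq_iteratedFDeriv_orthonormalBasis f b,
    iteratedFDeriv_two_apply]

theorem ContDiff.laplacian {f : E → F} {m n : WithTop ℕ∞} (hf : ContDiff ℝ n f)
    (h : m + 2 ≤ n) : ContDiff ℝ m (Δ f) := by
  have : Δ f = fun x ↦ ∑ i, fderiv ℝ (fderiv ℝ f) x (stdOrthonormalBasis ℝ E i)
      (stdOrthonormalBasis ℝ E i) :=
    funext fun x ↦ laplacian_apply_eq_sum_fderiv _ f x
  rw [this]
  have h1 : ContDiff ℝ (m + 1) (fderiv ℝ f) :=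
    hf.fderiv_right (by rw [add_assoc, one_add_one_eq_two]; exact h)
  have h2 : ContDiff ℝ m (fderiv ℝ (fderiv ℝ f)) := h1.fderiv_right le_rfl
  fun_prop

theorem laplacian_iterate_congr_nhds {f g : E → F} {x : E} (h : f =ᶠ[𝓝 x] g) (N : ℕ) :
    (Δ^[N] f : E → F) =ᶠ[𝓝 x] (Δ^[N] g : E → F) := by
  induction N with
  | zero => exact h
  | succ N ih =>
    rw [Function.iterate_succ_apply', Function.iterate_succ_apply']
    exact InnerProductSpace.laplacian_congr_nhds ih

end Laplacian

theorem hasCompactSupport_comp_norm_sq {E : Type*} [NormedAddCommGroup E] [ProperSpace E]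
    {ρ : ℝ → ℝ} (h : ∀ τ, 1 ≤ τ → ρ τ = 0) :
    HasCompactSupport fun z : E ↦ ρ (‖z‖ ^ 2) := by
  refine HasCompactSupport.intro (isCompact_closedBall (0 : E) 1) fun z hz ↦ h _ ?_
  rw [mem_closedBall_zero_iff, not_le] at hz
  exact one_le_pow₀ hz.le

/-! ### Radial averages and a finite Pizzetti formula -/

section Pizzetti

open scoped Laplacian RealInnerProductSpace

variable {E F : Type*} [NormedAddCommGroup E] [InnerProductSpace ℝ E] [FiniteDimensional ℝ E]
  [MeasurableSpace E] [BorelSpace E] [NormedAddCommGroup F] [NormedSpace ℝ F]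

/-- The field `-ρ(‖z‖²) z` is the gradient of `ρ₁(‖z‖²)`, so this is integration by parts in each
coordinate; the factor `s` comes from the chain rule. -/
theorem integral_radial_smul_fderiv_apply_self [CompleteSpace F] {ρ ρ₁ : ℝ → ℝ} (hρ : Continuous ρ)
    (hρ0 : ∀ τ, 1 ≤ τ → ρ τ = 0) (hρ₁ : ∀ τ, HasDerivAt ρ₁ (-ρ τ / 2) τ)
    (hρ₁0 : ∀ τ, 1 ≤ τ → ρ₁ τ = 0) {f : E → F} (hf : ContDiff ℝ 2 f) (x : E) (s : ℝ) :
    ∫ z, ρ (‖z‖ ^ 2) • fderiv ℝ f (x + s • z) z =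
      s • ∫ z, ρ₁ (‖z‖ ^ 2) • Δ f (x + s • z) := by
  let b := stdOrthonormalBasis ℝ E
  have hf1 : ContDiff ℝ 1 (fderiv ℝ f) := hf.fderiv_right (by norm_num [one_add_one_eq_two])
  have hf2 : Continuous (fderiv ℝ (fderiv ℝ f)) := hf1.continuous_fderiv one_ne_zero
  have hf1c : Continuous (fderiv ℝ f) := hf1.continuous
  have hρ₁c : Continuous ρ₁ := continuous_iff_continuousAt.2 fun τ ↦ (hρ₁ τ).continuousAt
  have hψ : ∀ z v : E, HasFDerivAt (fun z : E ↦ ρ₁ (‖z‖ ^ 2))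
      ((-ρ (‖z‖ ^ 2) / 2) • (2 • innerSL ℝ z)) z := fun z v ↦
    (hρ₁ (‖z‖ ^ 2)).comp_hasFDerivAt z (hasStrictFDerivAt_norm_sq z).hasFDerivAt
  have hψv : ∀ z v : E, fderiv ℝ (fun z : E ↦ ρ₁ (‖z‖ ^ 2)) z v = -(ρ (‖z‖ ^ 2) * ⟪z, v⟫) := by
    intro z v
    rw [(hψ z v).fderiv]
    simp
    ring
  have hg : ∀ i (z : E), HasFDerivAt (fun z ↦ fderiv ℝ f (x + s • z) (b i))
      ((ContinuousLinearMap.apply ℝ F (b i)).comp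
        ((fderiv ℝ (fderiv ℝ f) (x + s • z)).comp (s • ContinuousLinearMap.id ℝ E))) z := by
    intro i z
    have h1 : HasFDerivAt (fun z : E ↦ x + s • z) (s • ContinuousLinearMap.id ℝ E) z :=
      ((hasFDerivAt_id z).const_smul s).const_add x
    have h2 := (hf1.differentiable one_ne_zero (x + s • z)).hasFDerivAt.comp z h1
    exact (ContinuousLinearMap.apply ℝ F (b i)).hasFDerivAt.comp z h2
  have hgv : ∀ i (z : E), fderiv ℝ (fun z ↦ fderiv ℝ f (x + s • z) (b i)) z (b i) =
      s • fderiv ℝ (fderiv ℝ f) (x + s • z) (b i) (b i) := by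
    intro i z
    rw [(hg i z).fderiv]
    simp
  have hcρ := hasCompactSupport_comp_norm_sq (E := E) hρ0
  have hcρ₁ := hasCompactSupport_comp_norm_sq (E := E) hρ₁0
  have hpart : ∀ i, ∫ z, (ρ (‖z‖ ^ 2) * ⟪z, b i⟫) • fderiv ℝ f (x + s • z) (b i) =
      ∫ z, s • ρ₁ (‖z‖ ^ 2) • fderiv ℝ (fderiv ℝ f) (x + s • z) (b i) (b i) := by
    intro i
    have := integral_smul_fderiv_eq_neg_fderiv_smul_of_integrable (μ := (volume : Measure E))
      (f := fun z : E ↦ ρ₁ (‖z‖ ^ 2)) (g := fun z ↦ fderiv ℝ f (x + s • z) (b i)) (v := b i)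
      ?_ ?_ ?_ (fun z _ ↦ (hψ z (b i)).differentiableAt) (fun z _ ↦ (hg i z).differentiableAt)
    · simp_rw [hψv, hgv, neg_smul] at this
      rw [integral_neg, neg_neg] at this
      rw [← this]
      exact integral_congr_ae (ae_of_all _ fun z ↦ smul_comm _ _ _)
    · simp_rw [hψv]
      refine Continuous.integrable_of_hasCompactSupport (by fun_prop) ?_
      exact HasCompactSupport.smul_right (hcρ.mul_right.neg)
    · simp_rw [hgv]
      exact Continuous.integrable_of_hasCompactSupport (by fun_prop) hcρ₁.smul_right
    · exact Continuous.integrable_of_hasCompactSupport (by fun_prop) hcρ₁.smul_right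
  calc ∫ z, ρ (‖z‖ ^ 2) • fderiv ℝ f (x + s • z) z
      = ∫ z, ∑ i, (ρ (‖z‖ ^ 2) * ⟪z, b i⟫) • fderiv ℝ f (x + s • z) (b i) := by
        refine integral_congr_ae (ae_of_all _ fun z ↦ ?_)
        simp only
        have hz := congrArg (fderiv ℝ f (x + s • z)) (b.sum_repr' z)
        rw [← hz, map_sum, Finset.smul_sum]
        refine Finset.sum_congr rfl fun i _ ↦ ?_
        rw [map_smul, smul_smul, real_inner_comm]
    _ = ∑ i, ∫ z, s • ρ₁ (‖z‖ ^ 2) • fderiv ℝ (fderiv ℝ f) (x + s • z) (b i) (b i) := by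
        rw [integral_finsetSum]
        · exact Finset.sum_congr rfl fun i _ ↦ hpart i
        · intro i _
          exact Continuous.integrable_of_hasCompactSupport (by fun_prop)
            (hcρ.mul_right.smul_right)
    _ = s • ∫ z, ρ₁ (‖z‖ ^ 2) • Δ f (x + s • z) := by
        rw [← integral_finsetSum, ← integral_smul]
        · refine integral_congr_ae (ae_of_all _ fun z ↦ ?_)
          simp only
          rw [laplacian_apply_eq_sum_fderiv b, Finset.smul_sum, Finset.smul_sum]
        · intro i _
          exact Continuous.integrable_of_hasCompactSupport (by fun_prop)
            (hcρ₁.smul_right.smul_left (f := fun _ ↦ s))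

theorem hasDerivAt_integral_radial [CompleteSpace F] {ρ ρ₁ : ℝ → ℝ} (hρ : Continuous ρ)
    (hρ0 : ∀ τ, 1 ≤ τ → ρ τ = 0) (hρ₁ : ∀ τ, HasDerivAt ρ₁ (-ρ τ / 2) τ)
    (hρ₁0 : ∀ τ, 1 ≤ τ → ρ₁ τ = 0) {f : E → F} (hf : ContDiff ℝ 2 f) (x : E) (s : ℝ) :
    HasDerivAt (fun s : ℝ ↦ ∫ z, ρ (‖z‖ ^ 2) • f (x + s • z))
      (s • ∫ z, ρ₁ (‖z‖ ^ 2) • Δ f (x + s • z)) s := by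
  have hfc : Continuous f := hf.continuous
  have hf1c : Continuous (fderiv ℝ f) := hf.continuous_fderiv two_ne_zero
  have hout : ∀ z : E, z ∉ closedBall (0 : E) 1 → ρ (‖z‖ ^ 2) = 0 := by
    intro z hz
    rw [mem_closedBall_zero_iff, not_le] at hz
    exact hρ0 _ (one_le_pow₀ hz.le)
  have hset : ∀ g : E → F, ∫ z, ρ (‖z‖ ^ 2) • g z =
      ∫ z in closedBall (0 : E) 1, ρ (‖z‖ ^ 2) • g z := fun g ↦
    (setIntegral_eq_integral_of_forall_compl_eq_zero fun z hz ↦ by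
      rw [hout z hz, zero_smul]).symm
  rw [← integral_radial_smul_fderiv_apply_self hρ hρ0 hρ₁ hρ₁0 hf x s]
  have key := hasFDerivAt_setIntegral_of_isCompact (μ := (volume : Measure E))
    (isCompact_closedBall (0 : E) 1) isOpen_univ (mem_univ s)
    (h := fun (s : ℝ) z ↦ ρ (‖z‖ ^ 2) • f (x + s • z))
    (h' := fun s z ↦ ContinuousLinearMap.toSpanSingleton ℝ
      (ρ (‖z‖ ^ 2) • fderiv ℝ f (x + s • z) z))
    (fun s _ ↦ by fun_prop) ?_ ?_
  · have hint : Integrable (fun z ↦ ContinuousLinearMap.toSpanSingleton ℝ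
        (ρ (‖z‖ ^ 2) • fderiv ℝ f (x + s • z) z)) (volume.restrict (closedBall (0 : E) 1)) := by
      refine ContinuousOn.integrableOn_compact (isCompact_closedBall _ _) (Continuous.continuousOn ?_)
      exact (ContinuousLinearMap.toSpanSingletonCLE (𝕜 := ℝ) (E := F)).continuous.comp
        (by fun_prop)
    have key2 := key.hasDerivAt
    rw [ContinuousLinearMap.integral_apply hint] at key2
    simp only [ContinuousLinearMap.toSpanSingleton_apply, one_smul] at key2
    rw [hset]
    simp_rw [hset]
    exact key2
  · refine Continuous.continuousOn ?_
    exact (ContinuousLinearMap.toSpanSingletonCLE (𝕜 := ℝ) (E := F)).continuous.comp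
        (f := fun q : ℝ × E ↦ ρ (‖q.2‖ ^ 2) • fderiv ℝ f (x + q.1 • q.2) q.2) (by fun_prop)
  · intro s _ z _
    have h1 : HasDerivAt (fun s : ℝ ↦ x + s • z) z s := by
      simpa using ((hasDerivAt_id s).smul_const z).const_add x
    exact (((hf.differentiable two_ne_zero _).hasFDerivAt.comp_hasDerivAt s h1).const_smul
      _).hasFDerivAt

/-- A finite Pizzetti formula: radial averages of a polyharmonic function are polynomials in the
square of the radius. -/
theorem exists_integral_radial_eq_sum [CompleteSpace F] (N : ℕ) : ∀ {f : E → F},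
    ContDiff ℝ (2 * N : ℕ) f → ∀ {x : E} {R : ℝ}, (∀ y ∈ ball x R, (Δ^[N] f : E → F) y = 0) →
    ∀ {ρ : ℝ → ℝ}, Continuous ρ → (∀ τ, 1 ≤ τ → ρ τ = 0) →
    ∃ c : ℕ → F, ∀ s : ℝ, |s| < R →
      ∫ z, ρ (‖z‖ ^ 2) • f (x + s • z) = ∑ j ∈ Finset.range N, s ^ (2 * j) • c j := by
  induction N with
  | zero =>
    intro f _ x R hΔ ρ _ hρ0
    refine ⟨0, fun s hs ↦ ?_⟩
    simp only [Finset.range_zero, Finset.sum_empty]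
    refine integral_eq_zero_of_ae (ae_of_all _ fun z ↦ ?_)
    by_cases hz : 1 ≤ ‖z‖
    · simp [hρ0 _ (one_le_pow₀ hz)]
    · have : f (x + s • z) = 0 := by
        refine hΔ _ ?_
        rw [mem_ball, dist_eq_norm, add_sub_cancel_left, norm_smul, Real.norm_eq_abs]
        calc |s| * ‖z‖ ≤ |s| * 1 := by gcongr; exact (not_le.1 hz).le
          _ < R := by rwa [mul_one]
      simp [this]
  | succ N ih =>
    intro f hf x R hΔ ρ hρ hρ0
    -- The primitive is based at `1` so that it again vanishes on `[1, ∞)` and the induction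
    -- hypothesis applies to it.
    let ρ₁ : ℝ → ℝ := fun τ ↦ -(1 / 2) * ∫ σ in (1 : ℝ)..τ, ρ σ
    have hρ₁ : ∀ τ, HasDerivAt ρ₁ (-ρ τ / 2) τ := by
      intro τ
      have := (hρ.integral_hasStrictDerivAt 1 τ).hasDerivAt.const_mul (-(1 / 2))
      exact this.congr_deriv (by ring)
    have hρ₁0 : ∀ τ, 1 ≤ τ → ρ₁ τ = 0 := by
      intro τ hτ
      have : ∫ σ in (1 : ℝ)..τ, ρ σ = ∫ σ in (1 : ℝ)..τ, (0 : ℝ) := by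
        refine intervalIntegral.integral_congr fun σ hσ ↦ ?_
        rw [uIcc_of_le hτ] at hσ
        exact hρ0 σ hσ.1
      simp [ρ₁, this]
    have hf2 : ContDiff ℝ 2 f := hf.of_le (by norm_cast; omega)
    have hΔf : ContDiff ℝ (2 * N : ℕ) (Δ f) := hf.laplacian (by norm_cast)
    obtain ⟨c', hc'⟩ := ih hΔf (x := x) (R := R) hΔ
      (continuous_iff_continuousAt.2 fun τ ↦ (hρ₁ τ).continuousAt) hρ₁0
    let Φ : ℝ → F := fun s ↦ ∫ z, ρ (‖z‖ ^ 2) • f (x + s • z)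
    -- The average of `f` has derivative `s` times the polynomial for `Δ f`; integrating `s ^ (2 j +
    -- 1)` shifts the index and divides by `2 j + 2`.
    let c : ℕ → F := fun j ↦ Nat.casesOn j (Φ 0) fun j ↦ (2 * (j : ℝ) + 2)⁻¹ • c' j
    refine ⟨c, fun s hs ↦ ?_⟩
    let G : ℝ → F := fun s ↦ Φ s - ∑ j ∈ Finset.range N, s ^ (2 * (j + 1)) • c (j + 1)
    have hG : ∀ s ∈ Ioo (-R) R, HasDerivAt G 0 s := by
      intro s hs
      have h1 := hasDerivAt_integral_radial hρ hρ0 hρ₁ hρ₁0 hf2 x s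
      rw [hc' s (abs_lt.2 hs)] at h1
      have h2 : HasDerivAt (fun s : ℝ ↦ ∑ j ∈ Finset.range N, s ^ (2 * (j + 1)) • c (j + 1))
          (∑ j ∈ Finset.range N, s • s ^ (2 * j) • c' j) s := by
        refine HasDerivAt.fun_sum fun j _ ↦ ?_
        have h3 := (hasDerivAt_pow (2 * (j + 1)) s).smul_const (c (j + 1))
        convert h3 using 1
        simp only [c, smul_smul]
        congr 1
        have : (2 * (j : ℝ) + 2) ≠ 0 := by positivity
        have e : 2 * (j + 1) - 1 = 2 * j + 1 := by omega
        rw [e]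
        push_cast
        field_simp
        ring
      rw [Finset.smul_sum] at h1
      have h3 := h1.sub h2
      rw [sub_self] at h3
      exact h3
    have hconst : G s = G 0 := by
      refine isOpen_Ioo.is_const_of_deriv_eq_zero isPreconnected_Ioo
        (fun s hs ↦ (hG s hs).differentiableAt.differentiableWithinAt)
        (fun s hs ↦ (hG s hs).deriv) (abs_lt.1 hs) ?_
      have : 0 < R := (abs_nonneg s).trans_lt hs
      exact ⟨neg_lt_zero.2 this, this⟩
    have hG0 : G 0 = c 0 := by simp [G, c]
    rw [Finset.sum_range_succ', add_comm]
    simp only [mul_zero, pow_zero, one_smul]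
    rw [← hG0, ← hconst]
    simp [G, Φ]

end Pizzetti

/-! ### A mean value kernel for polyharmonic functions -/

section MeanValue

open scoped Laplacian

variable {E : Type*} [NormedAddCommGroup E] [InnerProductSpace ℝ E] [FiniteDimensional ℝ E]

/-- Lagrange interpolation at the nodes `s i ^ 2` reproduces `X ^ j` for `j < N`; evaluating at `0`
gives the weights. They will cancel every term of Pizzetti's polynomial except the constant one. -/
theorem exists_weights_sum_pow (N : ℕ) :
    ∃ (s a : Fin N → ℝ), (∀ i, 0 < s i ∧ s i ≤ 1) ∧
      ∀ j < N, ∑ i, a i * s i ^ (2 * j) = if j = 0 then 1 else 0 := by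
  let s : Fin N → ℝ := fun i ↦ ((i : ℝ) + 1) / N
  have hs : ∀ i, 0 < s i ∧ s i ≤ 1 := by
    intro i
    have hN : (0 : ℝ) < N := by exact_mod_cast i.pos
    refine ⟨by positivity, (div_le_one hN).2 ?_⟩
    exact_mod_cast i.2
  have hinj : Set.InjOn (fun i ↦ s i ^ 2) ((Finset.univ : Finset (Fin N)) : Set (Fin N)) := by
    intro i _ j _ hij
    have hN : (N : ℝ) ≠ 0 := by exact_mod_cast i.pos.ne'
    have h1 : s i = s j := (sq_eq_sq₀ (hs i).1.le (hs j).1.le).1 hij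
    have h2 : (i : ℝ) + 1 = j + 1 := by simpa [s, div_left_inj' hN] using h1
    exact Fin.ext (by exact_mod_cast add_right_cancel h2)
  refine ⟨s, fun i ↦ (Lagrange.basis Finset.univ (fun i ↦ s i ^ 2) i).eval 0, hs, fun j hj ↦ ?_⟩
  have h := Lagrange.eq_interpolate (f := (Polynomial.X ^ j : Polynomial ℝ)) hinj
    (by simpa using hj)
  have h0 := congrArg (Polynomial.eval 0) h
  simp only [Lagrange.interpolate_apply, Polynomial.eval_finsetSum, Polynomial.eval_mul,
    Polynomial.eval_C, Polynomial.eval_pow, Polynomial.eval_X] at h0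
  rw [zero_pow_eq] at h0
  rw [h0]
  refine Finset.sum_congr rfl fun i _ ↦ ?_
  rw [pow_mul, mul_comm]

/-- A weighted sum of dilates of one radial bump averages `f` at the radii `r * s i`, so only the
constant coefficient of the Pizzetti polynomial survives, namely `m • f x`. The kernel depends on
neither `f`, `x` nor `r`. -/
theorem exists_meanValue_kernel_of_contDiff [MeasurableSpace E] [BorelSpace E] (F : Type*)
    [NormedAddCommGroup F] [NormedSpace ℝ F] [CompleteSpace F] {N : ℕ} (hN : 1 ≤ N) :
    ∃ η : E → ℝ, ContDiff ℝ ∞ η ∧ (∀ z, 1 ≤ ‖z‖ → η z = 0) ∧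
      ∀ (f : E → F), ContDiff ℝ (2 * N : ℕ) f → ∀ (x : E) (R : ℝ),
        (∀ y ∈ ball x R, (Δ^[N] f : E → F) y = 0) →
        ∀ r, 0 ≤ r → r < R → f x = ∫ z, η z • f (x - r • z) := by
  let ρ : ℝ → ℝ := fun τ ↦ Real.smoothTransition (1 - τ)
  have hρ : ContDiff ℝ ∞ ρ := Real.smoothTransition.contDiff.comp (contDiff_const.sub contDiff_id)
  have hρ0 : ∀ τ, 1 ≤ τ → ρ τ = 0 := fun τ hτ ↦
    Real.smoothTransition.zero_of_nonpos (by linarith)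
  have hψc : Continuous fun z : E ↦ ρ (‖z‖ ^ 2) := hρ.continuous.comp (by fun_prop)
  let m : ℝ := ∫ z : E, ρ (‖z‖ ^ 2)
  have hm : 0 < m := by
    refine hψc.integral_pos_of_hasCompactSupport_nonneg_nonzero
      (hasCompactSupport_comp_norm_sq hρ0) (fun z ↦ Real.smoothTransition.nonneg _) (x := 0) ?_
    simp [ρ]
  obtain ⟨s, a, hs, ha⟩ := exists_weights_sum_pow N
  let n := Module.finrank ℝ E
  refine ⟨fun z ↦ ∑ i, (m⁻¹ * a i * |s i ^ n|⁻¹) * ρ (‖(s i)⁻¹ • z‖ ^ 2), ?_, ?_, ?_⟩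
  · refine ContDiff.sum fun i _ ↦ contDiff_const.mul (hρ.comp ?_)
    exact (contDiff_const.smul contDiff_id).norm_sq ℝ
  · intro z hz
    refine Finset.sum_eq_zero fun i _ ↦ ?_
    rw [hρ0, mul_zero]
    refine one_le_pow₀ ?_
    rw [norm_smul, norm_inv, Real.norm_of_nonneg (hs i).1.le, ← div_eq_inv_mul]
    exact (one_le_div (hs i).1).2 ((hs i).2.trans hz)
  · intro f hf x R hΔ r hr hrR
    obtain ⟨c, hc⟩ := exists_integral_radial_eq_sum N hf hΔ hρ.continuous hρ0
    -- At radius `0` the average is the mass of the bump times `f x`.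
    have hc0 : m • f x = c 0 := by
      have h0 := hc 0 (by rw [abs_zero]; exact hr.trans_lt hrR)
      obtain ⟨k, rfl⟩ : ∃ k, N = k + 1 := ⟨N - 1, by omega⟩
      rw [Finset.sum_range_succ'] at h0
      simp only [zero_smul, add_zero] at h0
      rw [integral_smul_const] at h0
      simpa [m] using h0
    have hfc := hf.continuous
    have hterm : ∀ i, ∫ z, ((m⁻¹ * a i * |s i ^ n|⁻¹) * ρ (‖(s i)⁻¹ • z‖ ^ 2)) • f (x - r • z) =
        ∑ j ∈ Finset.range N, (a i * s i ^ (2 * j)) • (m⁻¹ * r ^ (2 * j)) • c j := by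
      intro i
      have hsi := (hs i).1
      have e : ∀ z : E, ((m⁻¹ * a i * |s i ^ n|⁻¹) * ρ (‖(s i)⁻¹ • z‖ ^ 2)) • f (x - r • z) =
          (m⁻¹ * a i * |s i ^ n|⁻¹) • (fun w : E ↦ ρ (‖w‖ ^ 2) • f (x + (-(r * s i)) • w))
            ((s i)⁻¹ • z) := by
        intro z
        have e1 : (-(r * s i)) • (s i)⁻¹ • z = -(r • z) := by
          rw [smul_smul, neg_mul, mul_assoc, mul_inv_cancel₀ hsi.ne', mul_one, neg_smul]
        simp only
        rw [mul_smul, e1, ← sub_eq_add_neg]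
      have e2 := Measure.integral_comp_inv_smul (volume : Measure E)
        (fun w : E ↦ ρ (‖w‖ ^ 2) • f (x + (-(r * s i)) • w)) (s i)
      rw [integral_congr_ae (ae_of_all _ e), integral_smul, e2, hc, smul_smul, Finset.smul_sum]
      · refine Finset.sum_congr rfl fun j _ ↦ ?_
        rw [smul_smul, smul_smul]
        congr 1
        have : |s i ^ n| ≠ 0 := abs_ne_zero.2 (pow_ne_zero _ hsi.ne')
        rw [pow_mul (-(r * s i)), neg_sq, ← pow_mul, mul_pow]
        field_simp
        rfl
      · rw [abs_neg, abs_of_nonneg (mul_nonneg hr hsi.le)]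
        calc r * s i ≤ r * 1 := by gcongr; exact (hs i).2
          _ < R := by rwa [mul_one]
    simp_rw [Finset.sum_smul]
    rw [integral_finsetSum]
    · simp_rw [hterm]
      rw [Finset.sum_comm]
      simp_rw [← Finset.sum_smul]
      rw [Finset.sum_congr rfl fun j hj ↦ by rw [ha j (Finset.mem_range.1 hj)]]
      obtain ⟨k, rfl⟩ : ∃ k, N = k + 1 := ⟨N - 1, by omega⟩
      simp [← hc0, hm.ne']
    · intro i _
      refine Continuous.integrable_of_hasCompactSupport ?_ ?_
      · have := hψc.comp (continuous_const_smul (T := E) (s i)⁻¹)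
        simp only [Function.comp_def] at this
        fun_prop
      · have := (hasCompactSupport_comp_norm_sq (E := E) hρ0).comp_smul (inv_ne_zero (hs i).1.ne')
        exact this.mul_left.smul_right

/-- Multiplying `f` by a bump equal to `1` near the closed ball makes it globally smooth without
changing either side of the formula. -/
theorem exists_meanValue_kernel [MeasurableSpace E] [BorelSpace E] (F : Type*)
    [NormedAddCommGroup F] [NormedSpace ℝ F] [CompleteSpace F] {N : ℕ} (hN : 1 ≤ N) :
    ∃ η : E → ℝ, ContDiff ℝ ∞ η ∧ (∀ z, 1 ≤ ‖z‖ → η z = 0) ∧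
      ∀ (f : E → F) (U : Set E), IsOpen U → ContDiffOn ℝ (2 * N : ℕ) f U →
        (∀ y ∈ U, (Δ^[N] f : E → F) y = 0) →
        ∀ (x : E) (r : ℝ), 0 < r → closedBall x r ⊆ U → f x = ∫ z, η z • f (x - r • z) := by
  obtain ⟨η, hη, hη0, h⟩ := exists_meanValue_kernel_of_contDiff (E := E) F hN
  refine ⟨η, hη, hη0, fun f U hU hf hΔ x r hr hxr ↦ ?_⟩
  obtain ⟨δ, hδ, hδU⟩ := (isCompact_closedBall x r).exists_cthickening_subset_open hU hxr
  rw [cthickening_closedBall hδ.le hr.le] at hδU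
  let χ : ContDiffBump x := ⟨r + δ / 2, r + δ, by positivity, by linarith⟩
  have hχ1 : ∀ y ∈ closedBall x (r + δ / 2), χ y = 1 := fun y hy ↦ χ.one_of_mem_closedBall hy
  have hsub : closedBall x (r + δ) = tsupport χ := χ.tsupport_eq.symm
  have hg : ContDiff ℝ (2 * N : ℕ) fun y ↦ χ y • f y := by
    refine contDiff_iff_contDiffAt.2 fun y ↦ ?_
    by_cases hy : y ∈ tsupport χ
    · rw [← hsub] at hy
      rw [add_comm] at hδU
      exact χ.contDiffAt.smul (hf.contDiffAt (hU.mem_nhds (hδU hy)))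
    · have : (fun y ↦ χ y • f y) =ᶠ[𝓝 y] fun _ ↦ 0 := by
        filter_upwards [notMem_tsupport_iff_eventuallyEq.1 hy] with w hw
        simp [hw]
      exact contDiffAt_const.congr_of_eventuallyEq this
  have heq : ∀ y ∈ ball x (r + δ / 2), (fun y ↦ χ y • f y) =ᶠ[𝓝 y] f := by
    intro y hy
    filter_upwards [isOpen_ball.mem_nhds hy] with w hw
    simp [hχ1 w (ball_subset_closedBall hw)]
  have key := h (fun y ↦ χ y • f y) hg x (r + δ / 2) (fun y hy ↦ by
    rw [(laplacian_iterate_congr_nhds (heq y hy) N).eq_of_nhds]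
    refine hΔ y (hδU ?_)
    exact ball_subset_closedBall.trans (closedBall_subset_closedBall (by linarith)) hy)
    r hr.le (by linarith)
  rw [(heq x (mem_ball_self (by positivity))).eq_of_nhds] at key
  rw [key]
  refine integral_congr_ae (ae_of_all _ fun z ↦ ?_)
  by_cases hz : 1 ≤ ‖z‖
  · simp [hη0 z hz]
  · simp only
    rw [hχ1, one_smul]
    rw [mem_closedBall, dist_eq_norm, sub_sub_cancel_left, norm_neg, norm_smul,
      Real.norm_of_nonneg hr.le]
    calc r * ‖z‖ ≤ r * 1 := by gcongr; exact (not_le.1 hz).le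
      _ ≤ r + δ / 2 := by linarith

end MeanValue

/-! ### Factorial derivative bounds from the mean value property -/

theorem exists_closedBall_add_subset {E : Type*} [NormedAddCommGroup E] [NormedSpace ℝ E]
    [FiniteDimensional ℝ E] {U : Set E} (hU : IsOpen U) {x : E} {r : ℝ} (hr : 0 < r)
    (h : closedBall x r ⊆ U) : ∃ δ > 0, closedBall x (r + δ) ⊆ U := by
  have := FiniteDimensional.proper ℝ E
  obtain ⟨δ, hδ, hδU⟩ := (isCompact_closedBall x r).exists_cthickening_subset_open hU h
  rw [cthickening_closedBall hδ.le hr.le, add_comm] at hδU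
  exact ⟨δ, hδ, hδU⟩

theorem contDiff_rescaled_kernel {E : Type*} [NormedAddCommGroup E] [NormedSpace ℝ E]
    {η : E → ℝ} (hη : ContDiff ℝ ∞ η) (r : ℝ) :
    ContDiff ℝ ∞ fun t ↦ |r ^ Module.finrank ℝ E|⁻¹ * η (r⁻¹ • t) :=
  contDiff_const.mul (hη.comp (contDiff_const.smul contDiff_id))

theorem hasCompactSupport_rescaled_kernel {E : Type*} [NormedAddCommGroup E] [NormedSpace ℝ E]
    [FiniteDimensional ℝ E] {η : E → ℝ} (hη0 : ∀ z, 1 ≤ ‖z‖ → η z = 0) {r : ℝ} (hr : 0 < r) :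
    HasCompactSupport fun t ↦ |r ^ Module.finrank ℝ E|⁻¹ * η (r⁻¹ • t) := by
  have := FiniteDimensional.proper ℝ E
  refine HasCompactSupport.intro (isCompact_closedBall (0 : E) r) fun t ht ↦ ?_
  rw [mem_closedBall_zero_iff, not_le] at ht
  rw [hη0, mul_zero]
  rw [norm_smul, norm_inv, Real.norm_of_nonneg hr.le, ← div_eq_inv_mul, one_le_div hr]
  exact ht.le

/-- The function `f` is continuous on `U` and equal to its weighted averages with respect to all
rescalings of the kernel `η` supported in `U`. -/
def MeanValueOn {E F : Type*} [NormedAddCommGroup E] [NormedSpace ℝ E] [MeasurableSpace E]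
    [NormedAddCommGroup F] [NormedSpace ℝ F] (μ : Measure E) (η : E → ℝ) (f : E → F)
    (U : Set E) : Prop :=
  ContinuousOn f U ∧
    ∀ (x : E) (r : ℝ), 0 < r → closedBall x r ⊆ U → f x = ∫ z, η z • f (x - r • z) ∂μ

theorem MeanValueOn.locallyIntegrable_indicator {E F : Type*} [NormedAddCommGroup E]
    [NormedSpace ℝ E] [FiniteDimensional ℝ E] [MeasurableSpace E] [BorelSpace E]
    [NormedAddCommGroup F] [NormedSpace ℝ F] {μ : Measure E} [IsFiniteMeasureOnCompacts μ]
    {η : E → ℝ} {f : E → F}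
    {U : Set E} (h : MeanValueOn μ η f U) {x : E} {r : ℝ} (hU : closedBall x r ⊆ U) :
    LocallyIntegrable ((closedBall x r).indicator f) μ := by
  have := FiniteDimensional.proper ℝ E
  refine Integrable.locallyIntegrable ?_
  rw [integrable_indicator_iff isClosed_closedBall.measurableSet]
  exact (h.1.mono hU).integrableOn_compact (isCompact_closedBall _ _)

section MeanValueProperty

universe u

variable {E F : Type u} [NormedAddCommGroup E] [NormedSpace ℝ E] [FiniteDimensional ℝ E]
  [MeasurableSpace E] [BorelSpace E] {μ : Measure E} [μ.IsAddHaarMeasure]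
  [NormedAddCommGroup F] [NormedSpace ℝ F]

/-- The extra room `δ` lets one truncation of `f` serve all centres near `x`, so the averages become
a convolution with a smooth compactly supported function, which can be differentiated on the kernel
side. -/
theorem MeanValueOn.eventuallyEq_convolution {η : E → ℝ} (hη0 : ∀ z, 1 ≤ ‖z‖ → η z = 0)
    {f : E → F} {U : Set E} (h : MeanValueOn μ η f U) {x : E} {r δ : ℝ} (hr : 0 < r)
    (hδ : 0 < δ) (hδU : closedBall x (r + δ) ⊆ U) :
    f =ᶠ[𝓝 x] MeasureTheory.convolution
      (fun t ↦ |r ^ Module.finrank ℝ E|⁻¹ * η (r⁻¹ • t))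
      ((closedBall x (r + δ)).indicator f) (ContinuousLinearMap.lsmul ℝ ℝ) μ := by
  filter_upwards [ball_mem_nhds x hδ] with y hy
  have hsub : closedBall y r ⊆ closedBall x (r + δ) :=
    closedBall_subset_closedBall' (by rw [mem_ball] at hy; linarith)
  rw [h.2 y r hr (hsub.trans hδU), MeasureTheory.convolution]
  have e : ∀ t, ContinuousLinearMap.lsmul ℝ ℝ (|r ^ Module.finrank ℝ E|⁻¹ * η (r⁻¹ • t))
      ((closedBall x (r + δ)).indicator f (y - t)) =
      |r ^ Module.finrank ℝ E|⁻¹ • (fun w ↦ η w • f (y - r • w)) (r⁻¹ • t) := by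
    intro t
    simp only [ContinuousLinearMap.lsmul_apply, smul_inv_smul₀ hr.ne', mul_smul]
    by_cases ht : 1 ≤ ‖r⁻¹ • t‖
    · simp [hη0 _ ht]
    · rw [indicator_of_mem]
      refine hsub ?_
      rw [mem_closedBall, dist_eq_norm, sub_sub_cancel_left, norm_neg]
      rw [norm_smul, norm_inv, Real.norm_of_nonneg hr.le, ← div_eq_inv_mul, one_le_div hr] at ht
      exact (not_le.1 ht).le
  rw [integral_congr_ae (ae_of_all _ e), integral_smul,
    Measure.integral_comp_inv_smul μ (fun w ↦ η w • f (y - r • w)) r, smul_smul,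
    inv_mul_cancel₀ (abs_ne_zero.2 (pow_ne_zero _ hr.ne')), one_smul]

theorem MeanValueOn.contDiffOn {η : E → ℝ} (hη : ContDiff ℝ ∞ η)
    (hη0 : ∀ z, 1 ≤ ‖z‖ → η z = 0) {f : E → F} {U : Set E} (hU : IsOpen U)
    (h : MeanValueOn μ η f U) : ContDiffOn ℝ ∞ f U := by
  intro x hx
  obtain ⟨r, hr, hrU⟩ := nhds_basis_closedBall.mem_iff.1 (hU.mem_nhds hx)
  obtain ⟨δ, hδ, hδU⟩ := exists_closedBall_add_subset hU hr hrU
  refine ContDiffAt.contDiffWithinAt ?_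
  refine ContDiffAt.congr_of_eventuallyEq ?_ (h.eventuallyEq_convolution hη0 hr hδ hδU)
  exact ((hasCompactSupport_rescaled_kernel hη0 hr).contDiff_convolution_left _
    (n := (⊤ : ℕ∞)) (contDiff_rescaled_kernel hη r)
    (h.locallyIntegrable_indicator hδU)).contDiffAt

/-- The derivative falls on the kernel `r⁻ⁿ η(t / r)`; rescaling its integral leaves a single factor
`1 / r`. -/
theorem MeanValueOn.norm_fderiv_le {η : E → ℝ} (hη : ContDiff ℝ ∞ η)
    (hη0 : ∀ z, 1 ≤ ‖z‖ → η z = 0) {f : E → F} {U : Set E} (hU : IsOpen U)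
    (h : MeanValueOn μ η f U) {x : E} {r M : ℝ} (hr : 0 < r) (hrU : closedBall x r ⊆ U)
    (hM : ∀ y ∈ closedBall x r, ‖f y‖ ≤ M) :
    ‖fderiv ℝ f x‖ ≤ (∫ z, ‖fderiv ℝ η z‖ ∂μ) / r * M := by
  have hprop := FiniteDimensional.proper ℝ E
  obtain ⟨δ, hδ, hδU⟩ := exists_closedBall_add_subset hU hr hrU
  have hM0 : 0 ≤ M := (norm_nonneg _).trans (hM x (mem_closedBall_self hr.le))
  rw [(h.eventuallyEq_convolution hη0 hr hδ hδU).fderiv_eq,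
    ((hasCompactSupport_rescaled_kernel hη0 hr).hasFDerivAt_convolution_left _
      ((contDiff_rescaled_kernel hη r).of_le (by exact_mod_cast le_top))
      (h.locallyIntegrable_indicator hδU) x).fderiv, MeasureTheory.convolution]
  set V := |r ^ Module.finrank ℝ E| with hV
  have hV0 : V ≠ 0 := abs_ne_zero.2 (pow_ne_zero _ hr.ne')
  have hηd : Differentiable ℝ η := hη.differentiable (by simp)
  have hfd : ∀ t, fderiv ℝ (fun t ↦ V⁻¹ * η (r⁻¹ • t)) t =
      (V⁻¹ * r⁻¹) • fderiv ℝ η (r⁻¹ • t) := by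
    intro t
    have h1 : HasFDerivAt (fun t : E ↦ r⁻¹ • t) (r⁻¹ • ContinuousLinearMap.id ℝ E) t :=
      (hasFDerivAt_id t).const_smul r⁻¹
    have h2 := ((hηd (r⁻¹ • t)).hasFDerivAt.comp t h1).const_mul V⁻¹
    refine HasFDerivAt.fderiv (h2.congr_fderiv ?_)
    ext v
    simp
    ring
  have hη' : ∀ w : E, 1 < ‖w‖ → fderiv ℝ η w = 0 := by
    intro w hw
    have : η =ᶠ[𝓝 w] fun _ ↦ 0 := by
      filter_upwards [(isOpen_lt continuous_const continuous_norm).mem_nhds hw] with y hy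
      exact hη0 y (le_of_lt hy)
    rw [this.fderiv_eq]
    simp
  have hηc : HasCompactSupport η := HasCompactSupport.intro (isCompact_closedBall (0 : E) 1)
    fun z hz ↦ hη0 z (by rw [mem_closedBall_zero_iff, not_le] at hz; exact hz.le)
  have hint : Integrable (fun z ↦ ‖fderiv ℝ η z‖) μ :=
    ((hη.continuous_fderiv (by simp)).integrable_of_hasCompactSupport (hηc.fderiv ℝ)).norm
  have hint2 : Integrable (fun t ↦ V⁻¹ * r⁻¹ * M * ‖fderiv ℝ η (r⁻¹ • t)‖) μ :=
    (hint.comp_smul (inv_ne_zero hr.ne')).const_mul _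
  refine (norm_integral_le_of_norm_le hint2 (ae_of_all _ fun t ↦ ?_)).trans_eq ?_
  · have hpre : ∀ (A : E →L[ℝ] ℝ) (w : F),
        ‖(ContinuousLinearMap.lsmul ℝ ℝ).precompL E A w‖ ≤ ‖A‖ * ‖w‖ := by
      intro A w
      refine ContinuousLinearMap.opNorm_le_bound _ (by positivity) fun v ↦ ?_
      rw [ContinuousLinearMap.precompL_apply, ContinuousLinearMap.lsmul_apply, norm_smul]
      calc ‖A v‖ * ‖w‖ ≤ (‖A‖ * ‖v‖) * ‖w‖ := by gcongr; exact A.le_opNorm v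
        _ = ‖A‖ * ‖w‖ * ‖v‖ := by ring
    refine (hpre _ _).trans ?_
    rw [hfd, norm_smul, Real.norm_of_nonneg (by positivity)]
    by_cases ht : 1 < ‖r⁻¹ • t‖
    · simp [hη' _ ht]
    · have htr : ‖t‖ ≤ r := by
        rw [norm_smul, norm_inv, Real.norm_of_nonneg hr.le, ← div_eq_inv_mul, one_lt_div hr] at ht
        exact not_lt.1 ht
      have hmem : x - t ∈ closedBall x r := by
        rwa [mem_closedBall, dist_eq_norm, sub_sub_cancel_left, norm_neg]
      rw [indicator_of_mem (closedBall_subset_closedBall (by linarith) hmem)]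
      calc V⁻¹ * r⁻¹ * ‖fderiv ℝ η (r⁻¹ • t)‖ * ‖f (x - t)‖
          ≤ V⁻¹ * r⁻¹ * ‖fderiv ℝ η (r⁻¹ • t)‖ * M := by gcongr; exact hM _ hmem
        _ = _ := by ring
  · rw [integral_const_mul, Measure.integral_comp_inv_smul μ (fun z ↦ ‖fderiv ℝ η z‖) r, ← hV,
      smul_eq_mul]
    field_simp

/-- The kernel does not move with the centre, so differentiating the identity in the centre under
the integral reproduces it for the derivative. -/
theorem MeanValueOn.fderiv {η : E → ℝ} (hη : ContDiff ℝ ∞ η)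
    (hη0 : ∀ z, 1 ≤ ‖z‖ → η z = 0) {f : E → F} {U : Set E} (hU : IsOpen U)
    (h : MeanValueOn μ η f U) : MeanValueOn μ η (fderiv ℝ f) U := by
  have hprop := FiniteDimensional.proper ℝ E
  have hf := h.contDiffOn hη hη0 hU
  have hf' : ContinuousOn (_root_.fderiv ℝ f) U := hf.continuousOn_fderiv_of_isOpen hU (by simp)
  have hfd : ∀ y ∈ U, HasFDerivAt f (_root_.fderiv ℝ f y) y := fun y hy ↦
    ((hf.contDiffAt (hU.mem_nhds hy)).differentiableAt (by simp)).hasFDerivAt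
  refine ⟨hf', fun x r hr hrU ↦ ?_⟩
  obtain ⟨δ, hδ, hδU⟩ := exists_closedBall_add_subset hU hr hrU
  have hset : ∀ {G : Type u} [NormedAddCommGroup G] [NormedSpace ℝ G] (g : E → G),
      ∫ z, η z • g z ∂μ = ∫ z in closedBall (0 : E) 1, η z • g z ∂μ := fun g ↦
    (setIntegral_eq_integral_of_forall_compl_eq_zero fun z hz ↦ by
      rw [mem_closedBall_zero_iff, not_le] at hz
      rw [hη0 z hz.le, zero_smul]).symm
  have hmem : ∀ y ∈ ball x δ, ∀ z ∈ closedBall (0 : E) 1, y - r • z ∈ U := by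
    intro y hy z hz
    refine hδU ?_
    rw [mem_ball, dist_eq_norm] at hy
    rw [mem_closedBall_zero_iff] at hz
    rw [mem_closedBall, dist_eq_norm]
    calc ‖y - r • z - x‖ = ‖(y - x) - r • z‖ := by congr 1; abel
      _ ≤ ‖y - x‖ + ‖r • z‖ := norm_sub_le _ _
      _ = ‖y - x‖ + r * ‖z‖ := by rw [norm_smul, Real.norm_of_nonneg hr.le]
      _ ≤ δ + r * 1 := by gcongr
      _ = r + δ := by ring
  have key := hasFDerivAt_setIntegral_of_isCompact (μ := μ)
    (isCompact_closedBall (0 : E) 1) isOpen_ball (mem_ball_self hδ (x := x))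
    (h := fun y z ↦ η z • f (y - r • z))
    (h' := fun y z ↦ η z • _root_.fderiv ℝ f (y - r • z)) ?_ ?_ ?_
  · simp_rw [← hset] at key
    refine HasFDerivAt.fderiv (key.congr_of_eventuallyEq ?_)
    filter_upwards [ball_mem_nhds x hδ] with y hy
    refine h.2 y r hr (subset_trans ?_ hδU)
    exact closedBall_subset_closedBall' (by rw [mem_ball] at hy; linarith)
  · intro y hy
    refine hη.continuous.continuousOn.smul (h.1.comp (by fun_prop) fun z hz ↦ hmem y hy z hz)
  · refine ContinuousOn.smul (hη.continuous.comp continuous_snd).continuousOn ?_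
    exact hf'.comp (f := fun q : E × E ↦ q.1 - r • q.2) (by fun_prop)
      fun q hq ↦ hmem q.1 hq.1 q.2 hq.2
  · intro y hy z hz
    refine HasFDerivAt.const_smul ?_ _
    have h1 := hfd _ (hmem y hy z hz)
    exact h1.comp y ((hasFDerivAt_id y).sub_const _)

/-- Each of the `k` derivatives costs one step of radius `r`. The codomain is quantified inside the
induction because it changes from `F` to `E →L[ℝ] F`. -/
theorem MeanValueOn.norm_iteratedFDeriv_le {η : E → ℝ} (hη : ContDiff ℝ ∞ η)
    (hη0 : ∀ z, 1 ≤ ‖z‖ → η z = 0) {U : Set E} (hU : IsOpen U) (k : ℕ) :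
    ∀ {F : Type u} [NormedAddCommGroup F] [NormedSpace ℝ F] {f : E → F},
    MeanValueOn μ η f U → ∀ {x : E} {r M : ℝ}, 0 < r → closedBall x (k * r) ⊆ U →
    (∀ y ∈ closedBall x (k * r), ‖f y‖ ≤ M) →
    ‖iteratedFDeriv ℝ k f x‖ ≤ ((∫ z, ‖_root_.fderiv ℝ η z‖ ∂μ) / r) ^ k * M := by
  induction k with
  | zero =>
    intro F _ _ f _ x r M _ _ hM
    simpa using hM x (by simp)
  | succ k ih =>
    intro F _ _ f h x r M hr hsub hM
    have hball : ∀ y ∈ closedBall x (k * r), closedBall y r ⊆ closedBall x ((k + 1 : ℕ) * r) := by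
      intro y hy
      refine closedBall_subset_closedBall' ?_
      rw [mem_closedBall] at hy
      push_cast
      linarith
    rw [← norm_iteratedFDeriv_fderiv]
    have hkr : (k : ℝ) * r ≤ (k + 1 : ℕ) * r := by push_cast; nlinarith
    refine (ih (h.fderiv hη hη0 hU) hr ((closedBall_subset_closedBall hkr).trans hsub)
      (M := (∫ z, ‖_root_.fderiv ℝ η z‖ ∂μ) / r * M) fun y hy ↦ ?_).trans_eq ?_
    · exact h.norm_fderiv_le hη hη0 hU hr ((hball y hy).trans hsub)
        fun w hw ↦ hM w (hball y hy hw)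
    · rw [pow_succ, mul_assoc]

theorem MeanValueOn.exists_norm_iteratedFDeriv_le {η : E → ℝ} (hη : ContDiff ℝ ∞ η)
    (hη0 : ∀ z, 1 ≤ ‖z‖ → η z = 0) {U : Set E} (hU : IsOpen U) {f : E → F}
    (h : MeanValueOn μ η f U) {x : E} (hx : x ∈ U) :
    ∃ r > 0, ball x r ⊆ U ∧ ∃ M C : ℝ, 0 < C ∧
      ∀ k : ℕ, ∀ y ∈ ball x r, ‖iteratedFDeriv ℝ k f y‖ ≤ M * C ^ k * k ! := by
  have hprop := FiniteDimensional.proper ℝ E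
  obtain ⟨R, hR, hRU⟩ := nhds_basis_closedBall.mem_iff.1 (hU.mem_nhds hx)
  obtain ⟨M, hM⟩ := (isCompact_closedBall x R).exists_bound_of_continuousOn (h.1.mono hRU)
  have hM0 : 0 ≤ M := (norm_nonneg _).trans (hM x (mem_closedBall_self hR.le))
  set K := ∫ z, ‖_root_.fderiv ℝ η z‖ ∂μ with hK
  have hK0 : 0 ≤ K := integral_nonneg fun z ↦ norm_nonneg _
  have hsub : ball x (R / 2) ⊆ closedBall x R :=
    ball_subset_closedBall.trans (closedBall_subset_closedBall (by linarith))
  -- `K + 1` replaces `K` to keep the rate positive; `exp 1` comes from `k ^ k ≤ exp 1 ^ k * k !`.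
  refine ⟨R / 2, by positivity, hsub.trans hRU, M, (K + 1) * (2 / R) * Real.exp 1,
    by positivity, fun k y hy ↦ ?_⟩
  rcases Nat.eq_zero_or_pos k with rfl | hk
  · simpa using hM y (hsub hy)
  have hk' : (0 : ℝ) < k := by exact_mod_cast hk
  have hkr : (k : ℝ) * (R / 2 / k) = R / 2 := by field_simp
  have hyR : closedBall y (R / 2) ⊆ closedBall x R :=
    closedBall_subset_closedBall' (by rw [mem_ball] at hy; linarith)
  -- Splitting the available radius `R / 2` into `k` equal steps produces `k ^ k`.
  have := h.norm_iteratedFDeriv_le hη hη0 hU k (x := y) (r := R / 2 / k) (M := M) (by positivity)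
    (by rw [hkr]; exact hyR.trans hRU) (by rw [hkr]; exact fun w hw ↦ hM w (hyR hw))
  refine this.trans ?_
  have hexp : (k : ℝ) ^ k ≤ Real.exp 1 ^ k * k ! := by
    have := Real.pow_div_factorial_le_exp (k : ℝ) hk'.le k
    rw [div_le_iff₀ (by positivity)] at this
    rwa [← Real.exp_nat_mul, mul_one]
  rw [← hK]
  calc (K / (R / 2 / k)) ^ k * M = M * ((K * (2 / R)) ^ k * (k : ℝ) ^ k) := by
        rw [← mul_pow, mul_comm]
        congr 2
        field_simp
    _ ≤ M * (((K + 1) * (2 / R)) ^ k * (Real.exp 1 ^ k * k !)) := by gcongr; linarith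
    _ = _ := by rw [mul_pow _ (Real.exp 1)]; ring

end MeanValueProperty

/-! ### Analyticity of polyharmonic functions -/

theorem PolyharmonicOn.exists_meanValueOn {E : Type*} [NormedAddCommGroup E]
    [InnerProductSpace ℝ E] [FiniteDimensional ℝ E] [MeasurableSpace E] [BorelSpace E] {N : ℕ}
    (hN : 1 ≤ N) {f : E → ℂ} {U : Set E} (hU : IsOpen U) (hf : PolyharmonicOn N f U) :
    ∃ η : E → ℝ, ContDiff ℝ ∞ η ∧ (∀ z, 1 ≤ ‖z‖ → η z = 0) ∧ MeanValueOn volume η f U := by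
  obtain ⟨η, hη, hη0, h⟩ := exists_meanValue_kernel (E := E) ℂ hN
  exact ⟨η, hη, hη0, hf.1.continuousOn, h f U hU hf.1 hf.2⟩

/-- Polyharmonic functions are real analytic. -/
theorem PolyharmonicOn.analyticOnNhd {E : Type} [NormedAddCommGroup E]
    [InnerProductSpace ℝ E] [FiniteDimensional ℝ E] {N : ℕ}
    (hN : 1 ≤ N) {f : E → ℂ} {U : Set E} (hU : IsOpen U) (hf : PolyharmonicOn N f U) :
    AnalyticOnNhd ℝ f U := by
  borelize E
  obtain ⟨η, hη, hη0, h⟩ := hf.exists_meanValueOn hN hU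
  intro x hx
  obtain ⟨r, hr, hrU, M, C, hC, hb⟩ := h.exists_norm_iteratedFDeriv_le hη hη0 hU hx
  exact analyticAt_of_norm_iteratedFDeriv_le hr hC ((h.contDiffOn hη hη0 hU).mono hrU) hb

theorem PolyharmonicOn.exists_norm_iteratedFDeriv_fderiv_le {E : Type} [NormedAddCommGroup E]
    [InnerProductSpace ℝ E] [FiniteDimensional ℝ E] {N : ℕ}
    (hN : 1 ≤ N) {f : E → ℂ} {U : Set E} (hU : IsOpen U) (hf : PolyharmonicOn N f U) {x : E}
    (hx : x ∈ U) :
    ∃ r > 0, ball x r ⊆ U ∧ ∃ M C : ℝ, 0 < C ∧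
      ∀ k : ℕ, ∀ y ∈ ball x r, ‖iteratedFDeriv ℝ k (fderiv ℝ f) y‖ ≤ M * C ^ k * k ! := by
  borelize E
  obtain ⟨η, hη, hη0, h⟩ := hf.exists_meanValueOn hN hU
  exact (h.fderiv hη hη0 hU).exists_norm_iteratedFDeriv_le hη hη0 hU hx

/-! ### Analyticity of averages over contractions -/

theorem contDiffOn_uncurry_fderiv {E F : Type*} [NormedAddCommGroup E] [NormedSpace ℝ E]
    [NormedAddCommGroup F] [NormedSpace ℝ F]
    {Ω : Set (ℝ × E)} (hΩ : IsOpen Ω) {g : ℝ → E → F}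
    (hg : ContDiffOn ℝ ∞ (Function.uncurry g) Ω) :
    ContDiffOn ℝ ∞ (Function.uncurry fun s ↦ fderiv ℝ (g s)) Ω := by
  have h1 : ContDiffOn ℝ ∞ (fun q : ℝ × E ↦ (fderiv ℝ (Function.uncurry g) q).comp
      (ContinuousLinearMap.inr ℝ ℝ E)) Ω :=
    (hg.fderiv_of_isOpen hΩ (by simp)).clm_comp contDiffOn_const
  refine h1.congr fun q hq ↦ ?_
  have h2 : HasFDerivAt (Function.uncurry g) (fderiv ℝ (Function.uncurry g) q) (q.1, q.2) :=
    ((hg.contDiffAt (hΩ.mem_nhds hq)).differentiableAt (by simp)).hasFDerivAt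
  exact (h2.comp q.2 (hasFDerivAt_prodMk_right q.1 q.2)).fderiv

theorem norm_iteratedFDeriv_comp_contraction_le {E F : Type*} [NormedAddCommGroup E]
    [NormedSpace ℝ E] [NormedAddCommGroup F] [NormedSpace ℝ F]
    {h : E → F} {U : Set E} (hU : IsOpen U) (hh : ContDiffOn ℝ ∞ h U) (L : E →L[ℝ] E)
    (hL : ‖L‖ ≤ 1) {z : E} (hz : L z ∈ U) (k : ℕ) :
    ‖iteratedFDeriv ℝ k (h ∘ L) z‖ ≤ ‖iteratedFDeriv ℝ k h (L z)‖ := by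
  have hU' : IsOpen (L ⁻¹' U) := hU.preimage L.continuous
  have key := L.iteratedFDerivWithin_comp_right hh hU.uniqueDiffOn hU'.uniqueDiffOn hz (i := k)
    (by exact_mod_cast le_top)
  rw [iteratedFDerivWithin_of_isOpen k hU' hz, iteratedFDerivWithin_of_isOpen k hU hz] at key
  rw [key]
  refine (ContinuousMultilinearMap.norm_compContinuousLinearMap_le _ _).trans ?_
  refine mul_le_of_le_one_right (norm_nonneg _) ?_
  exact Finset.prod_le_one (fun _ _ ↦ norm_nonneg _) fun _ _ ↦ hL

section ParametricIntegral

universe u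

variable {E : Type u} [NormedAddCommGroup E] [NormedSpace ℝ E] [ProperSpace E]

theorem hasFDerivAt_setIntegral_of_contDiffOn {F : Type*} [NormedAddCommGroup F] [NormedSpace ℝ F]
    {K : Set ℝ} (hK : IsCompact K) {S : Set E} (hS : IsOpen S) {Ω : Set (ℝ × E)}
    (hΩ : IsOpen Ω) (hKS : K ×ˢ S ⊆ Ω) {g : ℝ → E → F}
    (hg : ContDiffOn ℝ ∞ (Function.uncurry g) Ω) {z : E} (hz : z ∈ S) :
    HasFDerivAt (fun z ↦ ∫ s in K, g s z) (∫ s in K, fderiv ℝ (g s) z) z := by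
  have hd : ∀ s ∈ K, ∀ z ∈ S, HasFDerivAt (g s)
      ((fderiv ℝ (Function.uncurry g) (s, z)).comp (ContinuousLinearMap.inr ℝ ℝ E)) z := by
    intro s hs z hz
    have h1 : HasFDerivAt (Function.uncurry g) (fderiv ℝ (Function.uncurry g) (s, z)) (s, z) :=
      ((hg.contDiffAt (hΩ.mem_nhds (hKS ⟨hs, hz⟩))).differentiableAt (by simp)).hasFDerivAt
    exact h1.comp z (hasFDerivAt_prodMk_right s z)
  refine hasFDerivAt_setIntegral_of_isCompact hK hS hz (h := fun z s ↦ g s z)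
    (h' := fun z s ↦ fderiv ℝ (g s) z) ?_ ?_ ?_
  · intro x hx
    exact hg.continuousOn.comp (f := fun s ↦ (s, x)) (by fun_prop) fun s hs ↦ hKS ⟨hs, hx⟩
  · have hc : ContinuousOn (fun q : E × ℝ ↦ (fderiv ℝ (Function.uncurry g) (q.2, q.1)).comp
        (ContinuousLinearMap.inr ℝ ℝ E)) (S ×ˢ K) := by
      have h1 := (hg.continuousOn_fderiv_of_isOpen hΩ (by simp)).comp
        (f := fun q : E × ℝ ↦ (q.2, q.1)) (s := S ×ˢ K) (by fun_prop)
        fun q hq ↦ hKS ⟨hq.2, hq.1⟩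
      exact h1.clm_comp continuousOn_const
    refine hc.congr fun q hq ↦ ?_
    exact (hd q.2 hq.2 q.1 hq.1).fderiv
  · intro x hx s hs
    rw [(hd s hs x hx).fderiv]
    exact hd s hs x hx

theorem contDiffOn_setIntegral {K : Set ℝ} (hK : IsCompact K) {S : Set E} (hS : IsOpen S)
    {Ω : Set (ℝ × E)} (hΩ : IsOpen Ω) (hKS : K ×ˢ S ⊆ Ω) (n : ℕ) :
    ∀ {F : Type u} [NormedAddCommGroup F] [NormedSpace ℝ F] {g : ℝ → E → F},
    ContDiffOn ℝ ∞ (Function.uncurry g) Ω → ContDiffOn ℝ n (fun z ↦ ∫ s in K, g s z) S := by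
  induction n with
  | zero =>
    intro F _ _ g hg
    refine contDiffOn_zero.2 fun z hz ↦ ?_
    exact (hasFDerivAt_setIntegral_of_contDiffOn hK hS hΩ hKS hg hz).continuousAt.continuousWithinAt
  | succ n ih =>
    intro F _ _ g hg
    push_cast
    refine (contDiffOn_succ_iff_fderiv_of_isOpen hS).2 ⟨fun z hz ↦ ?_, by simp, ?_⟩
    · exact (hasFDerivAt_setIntegral_of_contDiffOn hK hS hΩ hKS hg
        hz).differentiableAt.differentiableWithinAt
    · refine (ih (contDiffOn_uncurry_fderiv hΩ hg)).congr fun z hz ↦ ?_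
      exact (hasFDerivAt_setIntegral_of_contDiffOn hK hS hΩ hKS hg hz).fderiv

/-- All derivatives pass under the integral, so a bound uniform in the parameter keeps its growth
rate in `k`. -/
theorem norm_iteratedFDeriv_setIntegral_le {K : Set ℝ} (hK : IsCompact K) {S : Set E}
    (hS : IsOpen S) {Ω : Set (ℝ × E)} (hΩ : IsOpen Ω) (hKS : K ×ˢ S ⊆ Ω) (k : ℕ) :
    ∀ {F : Type u} [NormedAddCommGroup F] [NormedSpace ℝ F] {g : ℝ → E → F},
    ContDiffOn ℝ ∞ (Function.uncurry g) Ω → ∀ {z : E}, z ∈ S → ∀ {B : ℝ},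
    (∀ s ∈ K, ‖iteratedFDeriv ℝ k (g s) z‖ ≤ B) →
    ‖iteratedFDeriv ℝ k (fun z ↦ ∫ s in K, g s z) z‖ ≤ B * volume.real K := by
  induction k with
  | zero =>
    intro F _ _ g hg z hz B hB
    rw [norm_iteratedFDeriv_zero]
    refine norm_setIntegral_le_of_norm_le_const hK.measure_lt_top fun s hs ↦ ?_
    simpa using hB s hs
  | succ k ih =>
    intro F _ _ g hg z hz B hB
    rw [← norm_iteratedFDeriv_fderiv]
    have : fderiv ℝ (fun z ↦ ∫ s in K, g s z) =ᶠ[𝓝 z] fun z ↦ ∫ s in K, fderiv ℝ (g s) z := by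
      filter_upwards [hS.mem_nhds hz] with w hw
      exact (hasFDerivAt_setIntegral_of_contDiffOn hK hS hΩ hKS hg hw).fderiv
    rw [(Filter.EventuallyEq.iteratedFDeriv ℝ this k).eq_of_nhds]
    refine ih (contDiffOn_uncurry_fderiv hΩ hg) hz fun s hs ↦ ?_
    rw [norm_iteratedFDeriv_fderiv]
    exact hB s hs

/-- Averaging over a family of contractions fixing a point preserves analyticity at that point. -/
theorem analyticAt_setIntegral_comp {F : Type u} [NormedAddCommGroup F] [NormedSpace ℝ F]
    [CompleteSpace F] {K : Set ℝ} (hK : IsCompact K) {L : ℝ → E →L[ℝ] E}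
    (hL : ContDiff ℝ ∞ fun q : ℝ × E ↦ L q.1 q.2) (hL1 : ∀ s ∈ K, ‖L s‖ ≤ 1) {x : E}
    (hLx : ∀ s ∈ K, L s x = x) {h : E → F} {r M C : ℝ} (hr : 0 < r) (hC : 0 < C)
    (hh : ContDiffOn ℝ ∞ h (ball x r))
    (hb : ∀ k : ℕ, ∀ y ∈ ball x r, ‖iteratedFDeriv ℝ k h y‖ ≤ M * C ^ k * k !) :
    AnalyticAt ℝ (fun z ↦ ∫ s in K, h (L s z)) x := by
  have hmem : ∀ s ∈ K, ∀ z ∈ ball x r, L s z ∈ ball x r := by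
    intro s hs z hz
    rw [mem_ball, dist_eq_norm] at hz ⊢
    calc ‖L s z - x‖ = ‖L s (z - x)‖ := by rw [map_sub, hLx s hs]
      _ ≤ 1 * ‖z - x‖ := (L s).le_of_opNorm_le (hL1 s hs) _
      _ < r := by rwa [one_mul]
  have hΩ : IsOpen ((fun q : ℝ × E ↦ L q.1 q.2) ⁻¹' ball x r) :=
    isOpen_ball.preimage hL.continuous
  have hKS : K ×ˢ ball x r ⊆ (fun q : ℝ × E ↦ L q.1 q.2) ⁻¹' ball x r :=
    fun q hq ↦ hmem q.1 hq.1 q.2 hq.2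
  have hg : ContDiffOn ℝ ∞ (Function.uncurry fun s ↦ h ∘ L s)
      ((fun q : ℝ × E ↦ L q.1 q.2) ⁻¹' ball x r) :=
    hh.comp hL.contDiffOn fun q hq ↦ hq
  refine analyticAt_of_norm_iteratedFDeriv_le (M := M * volume.real K) hr hC ?_ fun k y hy ↦ ?_
  · exact contDiffOn_infty.2 fun n ↦ contDiffOn_setIntegral hK isOpen_ball hΩ hKS n hg
  · refine (norm_iteratedFDeriv_setIntegral_le hK isOpen_ball hΩ hKS k hg hy
      (B := M * C ^ k * k !) fun s hs ↦ ?_).trans_eq (by ring)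
    exact (norm_iteratedFDeriv_comp_contraction_le isOpen_ball hh (L s) (hL1 s hs) (hmem s hs y hy) k).trans
      (hb k _ (hmem s hs y hy))

end ParametricIntegral

/-! ### Calculus of directional derivatives -/

section DirectionalDerivative

open scoped Laplacian RealInnerProductSpace

variable {E F : Type*} [NormedAddCommGroup E] [NormedSpace ℝ E]
  [NormedAddCommGroup F] [NormedSpace ℝ F] {f g : E → F} {U : Set E} {z : E}

/-- The derivative of `f` in the direction `v`, as a function of the base point. -/
noncomputable def dirDeriv (v : E) (f : E → F) : E → F := fun z ↦ fderiv ℝ f z v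

theorem dirDeriv_congr_nhds (v : E) (h : f =ᶠ[𝓝 z] g) : dirDeriv v f =ᶠ[𝓝 z] dirDeriv v g := by
  filter_upwards [h.fderiv (𝕜 := ℝ)] with w hw
  simp [dirDeriv, hw]

theorem Set.EqOn.dirDeriv (v : E) (hU : IsOpen U) (h : EqOn f g U) :
    EqOn (dirDeriv v f) (dirDeriv v g) U := fun _ hz ↦
  (dirDeriv_congr_nhds v (h.eventuallyEq_of_mem (hU.mem_nhds hz))).eq_of_nhds

theorem dirDeriv_dirDeriv (hf : ContDiffAt ℝ 2 f z) (v w : E) :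
    dirDeriv w (dirDeriv v f) z = fderiv ℝ (fderiv ℝ f) z w v := by
  have h1 : DifferentiableAt ℝ (fderiv ℝ f) z :=
    (hf.fderiv_right (m := 1) (by norm_num [one_add_one_eq_two])).differentiableAt one_ne_zero
  have h2 := ((ContinuousLinearMap.apply ℝ F v).hasFDerivAt.comp z h1.hasFDerivAt).fderiv
  change fderiv ℝ ((ContinuousLinearMap.apply ℝ F v) ∘ fderiv ℝ f) z w = _
  rw [h2]
  rfl

theorem dirDeriv_comm (hf : ContDiffAt ℝ 2 f z) (v w : E) :
    dirDeriv w (dirDeriv v f) z = dirDeriv v (dirDeriv w f) z := by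
  rw [dirDeriv_dirDeriv hf, dirDeriv_dirDeriv hf]
  exact (hf.isSymmSndFDerivAt (by simp)).eq w v

theorem AnalyticOnNhd.dirDeriv [CompleteSpace F] (hf : AnalyticOnNhd ℝ f U) (v : E) :
    AnalyticOnNhd ℝ (dirDeriv v f) U :=
  (ContinuousLinearMap.apply ℝ F v).comp_analyticOnNhd hf.fderiv

theorem AnalyticOnNhd.dirDeriv_iterate [CompleteSpace F] (hf : AnalyticOnNhd ℝ f U) (v : E)
    (k : ℕ) : AnalyticOnNhd ℝ ((_root_.dirDeriv v)^[k] f) U := by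
  induction k with
  | zero => exact hf
  | succ k ih => rw [Function.iterate_succ_apply']; exact ih.dirDeriv v

theorem dirDeriv_add (hf : DifferentiableAt ℝ f z) (hg : DifferentiableAt ℝ g z) (v : E) :
    dirDeriv v (fun w ↦ f w + g w) z = dirDeriv v f z + dirDeriv v g z := by
  simp [dirDeriv, fderiv_fun_add hf hg]

theorem dirDeriv_sum {ι : Type*} (s : Finset ι) {f : ι → E → F} (hf : ∀ i ∈ s, DifferentiableAt ℝ (f i) z)
    (v : E) : dirDeriv v (fun w ↦ ∑ i ∈ s, f i w) z = ∑ i ∈ s, dirDeriv v (f i) z := by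
  simp [dirDeriv, fderiv_fun_sum hf]

theorem dirDeriv_const_smul (hf : DifferentiableAt ℝ f z) (c : ℝ) (v : E) :
    dirDeriv v (fun w ↦ c • f w) z = c • dirDeriv v f z := by
  simp [dirDeriv, fderiv_fun_const_smul hf c]

theorem dirDeriv_clm_smul (T : E →L[ℝ] ℝ) (hf : DifferentiableAt ℝ f z) (v : E) :
    dirDeriv v (fun w ↦ T w • f w) z = T z • dirDeriv v f z + T v • f z := by
  have h : HasFDerivAt (fun w ↦ T w • f w) (T z • fderiv ℝ f z + T.smulRight (f z)) z :=
    T.hasFDerivAt.smul hf.hasFDerivAt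
  simp only [dirDeriv]
  rw [h.fderiv]
  simp

theorem dirDeriv_clm_smul_add_const_smul (T : E →L[ℝ] ℝ) (c : ℝ) (hf : DifferentiableAt ℝ f z)
    (hg : DifferentiableAt ℝ g z) (v : E) :
    dirDeriv v (fun w ↦ T w • f w + c • g w) z =
      T z • dirDeriv v f z + T v • f z + c • dirDeriv v g z := by
  have h : DifferentiableAt ℝ (fun w ↦ T w • f w) z := T.differentiableAt.smul hf
  have h' : DifferentiableAt ℝ (fun w ↦ c • g w) z := hg.const_smul c
  rw [dirDeriv_add h h', dirDeriv_clm_smul T hf, dirDeriv_const_smul hg]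

/-- Leibniz's rule has only two terms because the second derivative of the linear factor is zero. -/
theorem iterate_dirDeriv_clm_smul [CompleteSpace F] (T : E →L[ℝ] ℝ) {v : E} (hv : T v = 1)
    (hU : IsOpen U) (hf : AnalyticOnNhd ℝ f U) (k : ℕ) :
    EqOn ((dirDeriv v)^[k + 1] fun w ↦ T w • f w)
      (fun z ↦ T z • (dirDeriv v)^[k + 1] f z + ((k : ℝ) + 1) • (dirDeriv v)^[k] f z) U := by
  induction k with
  | zero =>
    intro z hz
    simp [dirDeriv_clm_smul T (hf z hz).differentiableAt, hv]
  | succ k ih =>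
    intro z hz
    rw [Function.iterate_succ_apply', ih.dirDeriv v hU hz]
    have h1 := (hf.dirDeriv_iterate v (k + 1) z hz).differentiableAt
    have h0 := (hf.dirDeriv_iterate v k z hz).differentiableAt
    rw [dirDeriv_clm_smul_add_const_smul T _ h1 h0, hv]
    simp only [Function.iterate_succ_apply']
    push_cast
    module

/-- A function vanishing on a hyperplane section has vanishing tangential derivatives there. -/
theorem dirDeriv_eq_zero_of_forall_add_smul (hf : DifferentiableAt ℝ f z) {v : E}
    (h : ∀ s : ℝ, f (z + s • v) = 0) : dirDeriv v f z = 0 := by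
  have h0 : HasFDerivAt f (fderiv ℝ f z) (z + (0 : ℝ) • v) := by simpa using hf.hasFDerivAt
  have h1 : HasDerivAt (fun s : ℝ ↦ z + s • v) v 0 := by
    simpa using ((hasDerivAt_id (0 : ℝ)).smul_const v).const_add z
  have h2 := h0.comp_hasDerivAt (0 : ℝ) h1
  have h3 : (f ∘ fun s : ℝ ↦ z + s • v) = fun _ ↦ 0 := funext h
  rw [h3] at h2
  exact h2.unique (hasDerivAt_const _ _)

end DirectionalDerivative

/-! ### Commutation with a linear factor and the singular equation on the hyperplane -/

section LaplacianAlgebra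

open scoped Laplacian RealInnerProductSpace

variable {E F ι : Type*} [NormedAddCommGroup E] [InnerProductSpace ℝ E] [FiniteDimensional ℝ E]
  [NormedAddCommGroup F] [NormedSpace ℝ F] [Fintype ι] {f g : E → F} {U : Set E} {z : E}

theorem laplacian_eq_sum_dirDeriv (b : OrthonormalBasis ι ℝ E) (hf : ContDiffAt ℝ 2 f z) :
    Δ f z = ∑ i, dirDeriv (b i) (dirDeriv (b i) f) z := by
  rw [laplacian_apply_eq_sum_fderiv b]
  exact Finset.sum_congr rfl fun i _ ↦ (dirDeriv_dirDeriv hf _ _).symm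

theorem Set.EqOn.laplacian (hU : IsOpen U) (h : EqOn f g U) : EqOn (Δ f) (Δ g) U := fun _ hz ↦
  (InnerProductSpace.laplacian_congr_nhds (h.eventuallyEq_of_mem (hU.mem_nhds hz))).eq_of_nhds

theorem AnalyticOnNhd.laplacian [CompleteSpace F] (hf : AnalyticOnNhd ℝ f U) :
    AnalyticOnNhd ℝ (Δ f) U := by
  have : Δ f = fun x ↦ ∑ i, fderiv ℝ (fderiv ℝ f) x (stdOrthonormalBasis ℝ E i)
      (stdOrthonormalBasis ℝ E i) :=
    funext fun x ↦ laplacian_apply_eq_sum_fderiv _ f x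
  rw [this]
  refine Finset.analyticOnNhd_fun_sum _ fun i _ ↦ ?_
  have h1 := (ContinuousLinearMap.apply ℝ (E →L[ℝ] F)
    (stdOrthonormalBasis ℝ E i)).comp_analyticOnNhd hf.fderiv.fderiv
  exact (ContinuousLinearMap.apply ℝ F (stdOrthonormalBasis ℝ E i)).comp_analyticOnNhd h1

theorem AnalyticOnNhd.laplacian_iterate [CompleteSpace F] (hf : AnalyticOnNhd ℝ f U) (k : ℕ) :
    AnalyticOnNhd ℝ (Δ^[k] f : E → F) U := by
  induction k with
  | zero => exact hf
  | succ k ih => rw [Function.iterate_succ_apply']; exact ih.laplacian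

theorem dirDeriv_laplacian [CompleteSpace F] (hU : IsOpen U) (hf : AnalyticOnNhd ℝ f U) (v : E) :
    EqOn (dirDeriv v (Δ f)) (Δ (dirDeriv v f)) U := by
  let b := stdOrthonormalBasis ℝ E
  have h1 : EqOn (Δ f) (fun z ↦ ∑ i, dirDeriv (b i) (dirDeriv (b i) f) z) U := fun z hz ↦
    laplacian_eq_sum_dirDeriv b (hf z hz).contDiffAt
  intro z hz
  rw [h1.dirDeriv v hU hz, laplacian_eq_sum_dirDeriv b (hf.dirDeriv v z hz).contDiffAt,
    dirDeriv_sum _ fun i _ ↦ (((hf.dirDeriv _).dirDeriv _) z hz).differentiableAt]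
  refine Finset.sum_congr rfl fun i _ ↦ ?_
  rw [dirDeriv_comm (hf.dirDeriv _ z hz).contDiffAt]
  have h2 : EqOn (dirDeriv v (dirDeriv (b i) f)) (dirDeriv (b i) (dirDeriv v f)) U :=
    fun w hw ↦ dirDeriv_comm (hf w hw).contDiffAt _ _
  exact h2.dirDeriv _ hU hz

theorem iterate_dirDeriv_laplacian [CompleteSpace F] (hU : IsOpen U) (hf : AnalyticOnNhd ℝ f U)
    (v : E) (k : ℕ) : EqOn ((dirDeriv v)^[k] (Δ f)) (Δ ((dirDeriv v)^[k] f)) U := by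
  induction k with
  | zero => exact fun _ _ ↦ rfl
  | succ k ih =>
    intro z hz
    rw [Function.iterate_succ_apply', Function.iterate_succ_apply', ih.dirDeriv v hU hz,
      dirDeriv_laplacian hU (hf.dirDeriv_iterate v k) v hz]

theorem laplacian_inner_smul (b : OrthonormalBasis ι ℝ E) (i₀ : ι) (hf : ContDiffAt ℝ 2 f z) :
    Δ (fun w ↦ ⟪b i₀, w⟫ • f w) z = ⟪b i₀, z⟫ • Δ f z + (2 : ℝ) • dirDeriv (b i₀) f z := by
  classical
  let T := innerSL ℝ (b i₀)
  have hT : ∀ i, T (b i) = if i₀ = i then 1 else 0 := fun i ↦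
    orthonormal_iff_ite.1 b.orthonormal i₀ i
  have hd : ∀ᶠ w in 𝓝 z, DifferentiableAt ℝ f w :=
    (hf.eventually (by simp)).mono fun w hw ↦ hw.differentiableAt two_ne_zero
  have hf1 : ∀ v, DifferentiableAt ℝ (dirDeriv v f) z := fun v ↦
    (ContinuousLinearMap.apply ℝ F v).differentiableAt.comp z
      ((hf.fderiv_right (m := 1) (by norm_num [one_add_one_eq_two])).differentiableAt one_ne_zero)
  have hc : ContDiffAt ℝ 2 (fun w ↦ T w • f w) z := T.contDiff.contDiffAt.smul hf
  change Δ (fun w ↦ T w • f w) z = T z • Δ f z + (2 : ℝ) • dirDeriv (b i₀) f z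
  rw [laplacian_eq_sum_dirDeriv b hc, laplacian_eq_sum_dirDeriv b hf]
  have h2 : ∀ i, dirDeriv (b i) (dirDeriv (b i) fun w ↦ T w • f w) z =
      T z • dirDeriv (b i) (dirDeriv (b i) f) z + (2 * T (b i)) • dirDeriv (b i) f z := by
    intro i
    have h1 : dirDeriv (b i) (fun w ↦ T w • f w) =ᶠ[𝓝 z]
        fun w ↦ T w • dirDeriv (b i) f w + T (b i) • f w := by
      filter_upwards [hd] with w hw
      exact dirDeriv_clm_smul T hw _
    rw [(dirDeriv_congr_nhds (b i) h1).eq_of_nhds,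
      dirDeriv_clm_smul_add_const_smul T _ (hf1 _) hd.self_of_nhds]
    module
  simp_rw [h2, Finset.sum_add_distrib, hT, ← Finset.smul_sum]
  simp

/-- Each further `Δ` contributes another `2 ∂ₜ Δ^k f`, because `Δ` commutes with `∂ₜ`. -/
theorem iterate_laplacian_inner_smul [CompleteSpace F] (b : OrthonormalBasis ι ℝ E) (i₀ : ι)
    (hU : IsOpen U) (hf : AnalyticOnNhd ℝ f U) (k : ℕ) :
    EqOn (Δ^[k + 1] (fun w ↦ ⟪b i₀, w⟫ • f w) : E → F)
      (fun z ↦ ⟪b i₀, z⟫ • (Δ^[k + 1] f : E → F) z +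
        (2 * ((k : ℝ) + 1)) • dirDeriv (b i₀) (Δ^[k] f : E → F) z) U := by
  induction k with
  | zero =>
    intro z hz
    simp [laplacian_inner_smul b i₀ (hf z hz).contDiffAt]
  | succ k ih =>
    intro z hz
    rw [Function.iterate_succ_apply', ih.laplacian hU hz]
    have h1 := (hf.laplacian_iterate (k + 1) z hz).contDiffAt (n := 2)
    have h0 := (((hf.laplacian_iterate k).dirDeriv (b i₀)) z hz).contDiffAt (n := 2)
    have hT : ContDiffAt ℝ 2 (fun w ↦ ⟪b i₀, w⟫ • (Δ^[k + 1] f : E → F) w) z :=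
      (innerSL ℝ (b i₀)).contDiff.contDiffAt.smul h1
    have e1 := hT.laplacian_add (h0.const_smul (2 * ((k : ℝ) + 1)))
    have e2 := InnerProductSpace.laplacian_smul (2 * ((k : ℝ) + 1)) h0
    refine e1.trans ?_
    have e3 := dirDeriv_laplacian hU (hf.laplacian_iterate k) (b i₀) hz
    rw [laplacian_inner_smul b i₀ h1]
    refine (congrArg _ e2).trans ?_
    rw [← e3]
    simp only [Function.iterate_succ_apply']
    push_cast
    module

/-- If `f` vanishes on the hyperplane orthogonal to `b i₀`, only the normal part of the Laplacian
of `f` survives there. -/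
theorem laplacian_eq_dirDeriv_dirDeriv (b : OrthonormalBasis ι ℝ E) (i₀ : ι)
    (hU : ∀ z ∈ U, ∀ v, ⟪b i₀, v⟫ = 0 → z + v ∈ U) [CompleteSpace F] (hf : AnalyticOnNhd ℝ f U)
    (h0 : ∀ z ∈ U, ⟪b i₀, z⟫ = 0 → f z = 0) (hz : z ∈ U) (hz0 : ⟪b i₀, z⟫ = 0) :
    Δ f z = dirDeriv (b i₀) (dirDeriv (b i₀) f) z := by
  rw [laplacian_eq_sum_dirDeriv b (hf z hz).contDiffAt]
  refine Finset.sum_eq_single i₀ (fun i _ hi ↦ ?_) (by simp)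
  have hin : ⟪b i₀, b i⟫ = 0 := b.orthonormal.2 hi.symm
  have hin' : ∀ s : ℝ, ⟪b i₀, s • b i⟫ = 0 := fun s ↦ by rw [inner_smul_right, hin, mul_zero]
  -- Used twice: for `f`, then for its tangential derivative, which again vanishes on the
  -- hyperplane.
  have key : ∀ h : E → F, AnalyticOnNhd ℝ h U → (∀ z ∈ U, ⟪b i₀, z⟫ = 0 → h z = 0) →
      ∀ z ∈ U, ⟪b i₀, z⟫ = 0 → dirDeriv (b i) h z = 0 := by
    intro h hh hh0 z hz hz0
    refine dirDeriv_eq_zero_of_forall_add_smul (hh z hz).differentiableAt fun s ↦ ?_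
    exact hh0 _ (hU z hz _ (hin' s)) (by rw [inner_add_right, hz0, hin' s, add_zero])
  exact key _ (hf.dirDeriv _) (key f hf h0) z hz hz0

/-- A solution of `t Δ g + c ∂ₜ g = 0` with `c > 0` that vanishes on the hyperplane `t = 0` vanishes
there together with all its normal derivatives. -/
theorem iterate_dirDeriv_eq_zero [CompleteSpace F] (b : OrthonormalBasis ι ℝ E) (i₀ : ι)
    (hUo : IsOpen U) (hU : ∀ z ∈ U, ∀ v, ⟪b i₀, v⟫ = 0 → z + v ∈ U) (hg : AnalyticOnNhd ℝ g U)
    {c : ℝ} (hc : 0 < c)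
    (hpde : ∀ z ∈ U, ⟪b i₀, z⟫ • Δ g z + c • dirDeriv (b i₀) g z = 0)
    (h0 : ∀ z ∈ U, ⟪b i₀, z⟫ = 0 → g z = 0) (k : ℕ) :
    ∀ z ∈ U, ⟪b i₀, z⟫ = 0 → (dirDeriv (b i₀))^[k] g z = 0 := by
  induction k using Nat.strong_induction_on with
  | _ k ih =>
    match k with
    | 0 => exact h0
    | 1 =>
      intro z hz hz0
      have := hpde z hz
      rw [hz0, zero_smul, zero_add] at this
      exact (smul_eq_zero.1 this).resolve_left hc.ne'
    | k + 2 =>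
      intro z hz hz0
      let T := innerSL ℝ (b i₀)
      have hT1 : T (b i₀) = 1 := by simp [T]
      have hEq : EqOn (fun z ↦ T z • Δ g z) (fun z ↦ (-c) • dirDeriv (b i₀) g z) U := by
        intro z hz
        have := hpde z hz
        simp only [neg_smul]
        exact eq_neg_of_add_eq_zero_left this
      have hiter : ∀ (j : ℕ) (p q : E → F), EqOn p q U →
          EqOn ((dirDeriv (b i₀))^[j] p) ((dirDeriv (b i₀))^[j] q) U := by
        intro j p q hpq
        induction j with
        | zero => exact hpq
        | succ j ih =>
          rw [Function.iterate_succ_apply', Function.iterate_succ_apply']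
          exact ih.dirDeriv _ hUo
      have hsm : ∀ j : ℕ, EqOn ((dirDeriv (b i₀))^[j] fun z ↦ (-c) • dirDeriv (b i₀) g z)
          (fun z ↦ (-c) • (dirDeriv (b i₀))^[j + 1] g z) U := by
        intro j
        induction j with
        | zero => exact fun _ _ ↦ rfl
        | succ j ih =>
          intro w hw
          rw [Function.iterate_succ_apply', ih.dirDeriv _ hUo hw,
            dirDeriv_const_smul (hg.dirDeriv_iterate _ _ w hw).differentiableAt,
            Function.iterate_succ_apply' _ (j + 1)]
      -- Order `k + 1` is needed: on the hyperplane the linear factor consumes one derivative,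
      -- leaving `∂ₜ^k Δ g` against `∂ₜ^(k+2) g`.
      have e1 := hiter (k + 1) _ _ hEq hz
      rw [iterate_dirDeriv_clm_smul T hT1 hUo hg.laplacian k hz, hsm (k + 1) hz] at e1
      have hTz : T z = 0 := hz0
      simp only [hTz, zero_smul, zero_add] at e1
      rw [iterate_dirDeriv_laplacian hUo hg _ k hz,
        laplacian_eq_dirDeriv_dirDeriv b i₀ hU (hg.dirDeriv_iterate _ k)
          (ih k (by omega)) hz hz0] at e1
      simp only [← Function.iterate_succ_apply' (dirDeriv (b i₀))] at e1
      have e2 : ((k : ℝ) + 1 + c) • (dirDeriv (b i₀))^[k + 2] g z = 0 := by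
        rw [add_smul]
        refine (congrArg₂ (· + ·) e1 rfl).trans ?_
        module
      exact (smul_eq_zero.1 e2).resolve_left (by positivity)

end LaplacianAlgebra

/-! ### Invariance and linearity of iterated Laplacians -/

section LaplacianMore

open scoped Laplacian

variable {E F : Type*} [NormedAddCommGroup E] [InnerProductSpace ℝ E] [FiniteDimensional ℝ E]
  [NormedAddCommGroup F] [NormedSpace ℝ F] {f g : E → F} {U : Set E}

/-- The Laplacian may be computed in any orthonormal basis, and an isometry carries one such basis
to another. -/
theorem laplacian_comp_add_isometry (A : E ≃ₗᵢ[ℝ] E) (p : E) (f : E → F) :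
    Δ (fun z ↦ f (p + A z)) = fun z ↦ Δ f (p + A z) := by
  let b := stdOrthonormalBasis ℝ E
  rw [InnerProductSpace.laplacian_eq_iteratedFDeriv_orthonormalBasis _ b,
    InnerProductSpace.laplacian_eq_iteratedFDeriv_orthonormalBasis f (b.map A)]
  funext z
  refine Finset.sum_congr rfl fun i _ ↦ ?_
  have h1 := A.toContinuousLinearEquiv.iteratedFDerivWithin_comp_right (fun w ↦ f (p + w))
    uniqueDiffOn_univ (mem_univ (A z)) 2
  rw [preimage_univ, iteratedFDerivWithin_univ, iteratedFDerivWithin_univ] at h1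
  have h2 : ((fun w ↦ f (p + w)) ∘ A.toContinuousLinearEquiv) = fun z ↦ f (p + A z) := rfl
  rw [h2, iteratedFDeriv_comp_add_left] at h1
  rw [h1]
  simp only [ContinuousMultilinearMap.compContinuousLinearMap_apply]
  congr 1
  funext j
  fin_cases j <;> simp

theorem iterate_laplacian_comp_add_isometry (A : E ≃ₗᵢ[ℝ] E) (p : E) (f : E → F) (k : ℕ) :
    (Δ^[k] (fun z ↦ f (p + A z)) : E → F) = fun z ↦ (Δ^[k] f : E → F) (p + A z) := by
  induction k with
  | zero => rfl
  | succ k ih =>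
    rw [Function.iterate_succ_apply', ih, laplacian_comp_add_isometry,
      Function.iterate_succ_apply']

theorem iterate_laplacian_neg (f : E → F) (k : ℕ) :
    (Δ^[k] (-f) : E → F) = -(Δ^[k] f : E → F) := by
  induction k with
  | zero => rfl
  | succ k ih =>
    rw [Function.iterate_succ_apply', ih, InnerProductSpace.laplacian_neg,
      Function.iterate_succ_apply']

theorem Set.EqOn.iterate_laplacian (hU : IsOpen U) (h : EqOn f g U) (k : ℕ) :
    EqOn (Δ^[k] f : E → F) (Δ^[k] g) U := fun _ hz ↦
  (laplacian_iterate_congr_nhds (h.eventuallyEq_of_mem (hU.mem_nhds hz)) k).eq_of_nhds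

theorem iterate_laplacian_add [CompleteSpace F] (hU : IsOpen U) (hf : AnalyticOnNhd ℝ f U)
    (hg : AnalyticOnNhd ℝ g U) (k : ℕ) :
    EqOn (Δ^[k] (f + g) : E → F) ((Δ^[k] f : E → F) + (Δ^[k] g : E → F)) U := by
  induction k with
  | zero => exact fun _ _ ↦ rfl
  | succ k ih =>
    intro z hz
    rw [Function.iterate_succ_apply', ih.laplacian hU hz,
      (hf.laplacian_iterate k z hz).contDiffAt.laplacian_add
        (hg.laplacian_iterate k z hz).contDiffAt,
      Pi.add_apply, Function.iterate_succ_apply', Function.iterate_succ_apply']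

end LaplacianMore

/-- The one-variable identity theorem on a line: the restriction of `g` has infinite vanishing order
at `0`, so only the parameter interval has to be connected. -/
theorem eq_zero_of_iterate_dirDeriv_eq_zero {E F : Type*} [NormedAddCommGroup E]
    [NormedSpace ℝ E] [NormedAddCommGroup F] [NormedSpace ℝ F] [CompleteSpace F] {g : E → F}
    {U : Set E} (hg : AnalyticOnNhd ℝ g U) {z v : E} {I : Set ℝ} (hI : IsOpen I)
    (hIc : IsPreconnected I) (h0I : (0 : ℝ) ∈ I) (hIU : ∀ s ∈ I, z + s • v ∈ U)
    (h : ∀ k, (dirDeriv v)^[k] g z = 0) {s : ℝ} (hs : s ∈ I) : g (z + s • v) = 0 := by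
  let γ : ℝ → F := fun s ↦ g (z + s • v)
  have hγ : AnalyticOnNhd ℝ γ I := by
    refine AnalyticOnNhd.comp (g := g) (f := fun s : ℝ ↦ z + s • v) hg ?_ hIU
    exact analyticOnNhd_const.add (analyticOnNhd_id.smul analyticOnNhd_const)
  have hiter : ∀ k, EqOn (iteratedDeriv k γ) (fun s ↦ (dirDeriv v)^[k] g (z + s • v)) I := by
    intro k
    induction k with
    | zero => intro s _; simp [γ]
    | succ k ih =>
      intro s hs
      rw [iteratedDeriv_succ, (ih.eventuallyEq_of_mem (hI.mem_nhds hs)).deriv_eq,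
        (hg.dirDeriv_iterate v k _ (hIU s hs)).differentiableAt.deriv_comp_add_smul]
      simp only [Function.iterate_succ_apply']
      rfl
  have hzero : γ =ᶠ[𝓝 0] 0 := by
    refine analyticOrderAt_eq_top.1 ?_
    refine ENat.eq_top_iff_forall_ge.2 fun n ↦ ?_
    rw [natCast_le_analyticOrderAt_iff_iteratedDeriv_eq_zero (hγ 0 h0I)]
    intro i _
    rw [hiter i h0I]
    simpa using h i
  exact hγ.eqOn_zero_of_preconnected_of_eventuallyEq_zero hIc h0I hzero hs

/-! ### The strip, its reflection, and division by time -/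

section Strip

open scoped Laplacian RealInnerProductSpace

variable {d : ℕ}

/-- The orthonormal basis of `ℝ × ℝ^d` consisting of the time direction and the standard basis
of `ℝ^d`. -/
noncomputable def timeBasis (d : ℕ) : OrthonormalBasis (Unit ⊕ Fin d) ℝ (TimeSpace d) :=
  (OrthonormalBasis.singleton Unit ℝ).prod (EuclideanSpace.basisFun (Fin d) ℝ)

theorem timeBasis_inl : timeBasis d (Sum.inl ()) = TimeSpace.mk 1 0 := by
  simp [timeBasis]

theorem inner_timeBasis_inl (z : TimeSpace d) : ⟪timeBasis d (Sum.inl ()), z⟫ = z.fst := by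
  rw [timeBasis_inl, WithLp.prod_inner_apply]
  simp

theorem isOpen_strip (d : ℕ) (a b : ℝ) : IsOpen (strip d a b) :=
  isOpen_Ioo.preimage (WithLp.fstL 2 ℝ ℝ (EuclideanSpace ℝ (Fin d))).continuous

/-- The reflection `(t, y) ↦ (-t, y)`. -/
noncomputable def timeReflection (d : ℕ) : TimeSpace d ≃ₗᵢ[ℝ] TimeSpace d where
  toFun z := TimeSpace.mk (-z.fst) z.snd
  invFun z := TimeSpace.mk (-z.fst) z.snd
  map_add' z w := by
    apply (WithLp.equiv 2 _).injective
    simp [add_comm]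
  map_smul' c z := by
    apply (WithLp.equiv 2 _).injective
    simp
  left_inv z := by
    apply (WithLp.equiv 2 _).injective
    simp [Prod.ext_iff]
  right_inv z := by
    apply (WithLp.equiv 2 _).injective
    simp [Prod.ext_iff]
  norm_map' z := by
    rw [← sq_eq_sq₀ (norm_nonneg _) (norm_nonneg _), WithLp.prod_norm_sq_eq_of_L2,
      WithLp.prod_norm_sq_eq_of_L2]
    simp

theorem timeReflection_mk (t : ℝ) (y : EuclideanSpace ℝ (Fin d)) :
    timeReflection d (TimeSpace.mk t y) = TimeSpace.mk (-t) y := rfl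

/-- The map `(t, y) ↦ (s t, y)`. -/
noncomputable def timeScale (d : ℕ) (s : ℝ) : TimeSpace d →L[ℝ] TimeSpace d :=
  ContinuousLinearMap.id ℝ _ + (s - 1) •
    (WithLp.fstL 2 ℝ ℝ (EuclideanSpace ℝ (Fin d))).smulRight (TimeSpace.mk 1 0)

theorem timeScale_apply (s : ℝ) (z : TimeSpace d) :
    timeScale d s z = z + ((s - 1) * z.fst) • TimeSpace.mk 1 0 := by
  simp [timeScale, smul_smul]

theorem timeScale_mk (s t : ℝ) (y : EuclideanSpace ℝ (Fin d)) :
    timeScale d s (TimeSpace.mk t y) = TimeSpace.mk (s * t) y := by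
  rw [timeScale_apply]
  apply (WithLp.equiv 2 _).injective
  simp [Prod.ext_iff]
  ring

theorem norm_timeScale_le {s : ℝ} (hs : s ∈ Icc (0 : ℝ) 1) : ‖timeScale d s‖ ≤ 1 := by
  refine ContinuousLinearMap.opNorm_le_bound _ zero_le_one fun z ↦ ?_
  rw [one_mul, ← sq_le_sq₀ (norm_nonneg _) (norm_nonneg _)]
  have : z = TimeSpace.mk z.fst z.snd := rfl
  rw [this, timeScale_mk, WithLp.prod_norm_sq_eq_of_L2, WithLp.prod_norm_sq_eq_of_L2]
  simp only [Real.norm_eq_abs, sq_abs]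
  refine add_le_add ?_ le_rfl
  change (s * z.fst) ^ 2 ≤ z.fst ^ 2
  rw [mul_pow]
  exact mul_le_of_le_one_left (sq_nonneg _) (pow_le_one₀ hs.1 hs.2)

theorem contDiff_timeScale : ContDiff ℝ ∞ fun q : ℝ × TimeSpace d ↦ timeScale d q.1 q.2 := by
  simp_rw [timeScale_apply]
  have h : ContDiff ℝ ∞ fun q : ℝ × TimeSpace d ↦ q.2.fst :=
    (WithLp.fstL 2 ℝ ℝ (EuclideanSpace ℝ (Fin d))).contDiff.comp contDiff_snd
  exact contDiff_snd.add (((contDiff_fst.sub contDiff_const).mul h).smul contDiff_const)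

theorem timeScale_mem_strip {c s : ℝ} (hs : s ∈ Icc (0 : ℝ) 1) {z : TimeSpace d}
    (hz : z ∈ strip d (-c) c) : timeScale d s z ∈ strip d (-c) c := by
  have h1 : |z.fst| < c := abs_lt.2 hz
  have : (timeScale d s z).fst = s * z.fst := by
    have : z = TimeSpace.mk z.fst z.snd := rfl
    rw [this, timeScale_mk]
    rfl
  change (timeScale d s z).fst ∈ Ioo (-c) c
  rw [this, mem_Ioo, ← abs_lt, abs_mul, abs_of_nonneg hs.1]
  exact (mul_le_of_le_one_left (abs_nonneg _) hs.2).trans_lt h1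

/-- The quotient `f (t, y) / t` of a function vanishing for `t = 0`, as an average of the time
derivative. -/
noncomputable def timeQuotient (f : TimeSpace d → ℂ) (z : TimeSpace d) : ℂ :=
  (∫ s in Icc (0 : ℝ) 1, fderiv ℝ f (timeScale d s z)) (TimeSpace.mk 1 0)

theorem fst_smul_timeQuotient {c : ℝ} {f : TimeSpace d → ℂ}
    (hf : AnalyticOnNhd ℝ f (strip d (-c) c))
    (hf0 : ∀ y : EuclideanSpace ℝ (Fin d), f (TimeSpace.mk 0 y) = 0) {z : TimeSpace d}
    (hz : z ∈ strip d (-c) c) : z.fst • timeQuotient f z = f z := by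
  have hcont : ContinuousOn (fun s : ℝ ↦ fderiv ℝ f (timeScale d s z)) (Icc 0 1) := by
    refine hf.fderiv.continuousOn.comp (f := fun s : ℝ ↦ timeScale d s z) ?_ fun s hs ↦
      timeScale_mem_strip hs hz
    exact (contDiff_timeScale.continuous.comp (by fun_prop : Continuous fun s : ℝ ↦
      (s, z))).continuousOn
  have hcont' : ContinuousOn (fun s : ℝ ↦ z.fst • fderiv ℝ f (timeScale d s z)
      (TimeSpace.mk 1 0)) (Icc 0 1) :=
    (hcont.clm_apply continuousOn_const).const_smul z.fst
  rw [timeQuotient, ContinuousLinearMap.integral_apply (hcont.integrableOn_compact isCompact_Icc),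
    ← integral_smul, integral_Icc_eq_integral_Ioc, ← intervalIntegral.integral_of_le zero_le_one]
  have hder : ∀ s ∈ uIcc (0 : ℝ) 1, HasDerivAt (fun s ↦ f (timeScale d s z))
      (z.fst • fderiv ℝ f (timeScale d s z) (TimeSpace.mk 1 0)) s := by
    intro s hs
    rw [uIcc_of_le zero_le_one] at hs
    have h1 : HasDerivAt (fun s ↦ timeScale d s z) (z.fst • TimeSpace.mk 1 0) s := by
      simp_rw [timeScale_apply]
      have := ((((hasDerivAt_id s).sub_const 1).mul_const z.fst).smul_const
        (TimeSpace.mk 1 0 : TimeSpace d)).const_add z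
      simpa using this
    have h2 := (hf _ (timeScale_mem_strip hs hz)).differentiableAt.hasFDerivAt.comp_hasDerivAt s h1
    rwa [map_smul] at h2
  rw [intervalIntegral.integral_eq_sub_of_hasDerivAt hder
    (by rw [← uIcc_of_le zero_le_one] at hcont'; exact hcont'.intervalIntegrable)]
  have e : z = TimeSpace.mk z.fst z.snd := rfl
  rw [e, timeScale_mk, timeScale_mk, one_mul, zero_mul, hf0, sub_zero]

/-- Off `t = 0` this is a quotient of analytic functions. At a point with `t = 0` every `timeScale d
s`, `s ∈ [0, 1]`, is a contraction fixing that point, so the factorial bounds for `fderiv ℝ f` pass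
to the average. -/
theorem analyticOnNhd_timeQuotient {N : ℕ} (hN : 1 ≤ N) {c : ℝ} {f : TimeSpace d → ℂ}
    (hf : PolyharmonicOn N f (strip d (-c) c))
    (hf0 : ∀ y : EuclideanSpace ℝ (Fin d), f (TimeSpace.mk 0 y) = 0) :
    AnalyticOnNhd ℝ (timeQuotient f) (strip d (-c) c) := by
  have hV := isOpen_strip d (-c) c
  have hfa := hf.analyticOnNhd hN hV
  intro z hz
  by_cases hz0 : z.fst = 0
  · obtain ⟨r, hr, hrU, M, C, hC, hb⟩ := hf.exists_norm_iteratedFDeriv_fderiv_le hN hV hz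
    have hs : ContDiffOn ℝ ∞ (fderiv ℝ f) (ball z r) :=
      fun w hw ↦ (hfa.fderiv w (hrU hw)).contDiffAt.contDiffWithinAt
    have key := analyticAt_setIntegral_comp (isCompact_Icc (a := (0 : ℝ)) (b := 1))
      contDiff_timeScale (fun s hs ↦ norm_timeScale_le hs) (x := z)
      (fun s _ ↦ by rw [timeScale_apply, hz0]; simp) hr hC hs hb
    exact ((ContinuousLinearMap.apply ℝ ℂ (TimeSpace.mk 1 0 : TimeSpace d)).analyticAt _).comp key
  · have hfst : AnalyticAt ℝ (fun w : TimeSpace d ↦ w.fst) z :=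
      (WithLp.fstL 2 ℝ ℝ (EuclideanSpace ℝ (Fin d))).analyticAt z
    refine ((hfst.inv hz0).smul (hfa z hz)).congr ?_
    filter_upwards [hV.mem_nhds hz, hfst.continuousAt.eventually_ne hz0] with w hw hw0
    simp only [Pi.smul_apply', Pi.inv_apply]
    rw [← fst_smul_timeQuotient hfa hf0 hw, inv_smul_smul₀ hw0]

theorem timeQuotient_timeReflection {c : ℝ} {f : TimeSpace d → ℂ}
    (hf : AnalyticOnNhd ℝ f (strip d (-c) c))
    (hf0 : ∀ y : EuclideanSpace ℝ (Fin d), f (TimeSpace.mk 0 y) = 0)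
    (heven : ∀ z, f (timeReflection d z) = f z) {z : TimeSpace d} (hz : z ∈ strip d (-c) c) :
    timeQuotient f (timeReflection d z) = -timeQuotient f z := by
  have hRz : timeReflection d z ∈ strip d (-c) c := by
    change -z.fst ∈ Ioo (-c) c
    exact ⟨neg_lt_neg hz.2, neg_lt.1 hz.1⟩
  -- Where division by `t` is impossible, oddness means that the quotient is zero: it equals `∂ₜ f`,
  -- which vanishes for an even function.
  by_cases hz0 : z.fst = 0
  · have hR : timeReflection d z = z := by
      have e : z = TimeSpace.mk z.fst z.snd := rfl
      rw [e, timeReflection_mk, hz0, neg_zero]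
    have hs : ∀ s, timeScale d s z = z := fun s ↦ by rw [timeScale_apply, hz0]; simp
    have hD : timeQuotient f z = fderiv ℝ f z (TimeSpace.mk 1 0) := by
      simp [timeQuotient, hs]
    have h1 : HasDerivAt (fun s : ℝ ↦ z + s • (TimeSpace.mk 1 0 : TimeSpace d))
        (TimeSpace.mk 1 0) 0 := by
      simpa using ((hasDerivAt_id (0 : ℝ)).smul_const _).const_add z
    have h0 : HasFDerivAt f (fderiv ℝ f z) (z + (0 : ℝ) • (TimeSpace.mk 1 0 : TimeSpace d)) := by
      simpa using (hf z hz).differentiableAt.hasFDerivAt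
    have h2 := h0.comp_hasDerivAt (0 : ℝ) h1
    have h3 : HasDerivAt (f ∘ fun s : ℝ ↦ z + s • (TimeSpace.mk 1 0 : TimeSpace d))
        (fderiv ℝ f z (TimeSpace.mk 1 0)) (-0 : ℝ) := by simpa using h2
    have h4 := h3.scomp (0 : ℝ) (hasDerivAt_neg (0 : ℝ))
    have h5 : (f ∘ fun s : ℝ ↦ z + s • (TimeSpace.mk 1 0 : TimeSpace d)) ∘ Neg.neg =
        f ∘ fun s : ℝ ↦ z + s • (TimeSpace.mk 1 0 : TimeSpace d) := by
      funext s
      simp only [Function.comp_apply]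
      rw [← heven (z + s • _), map_add, hR, map_smul, timeReflection_mk]
      congr 2
      apply (WithLp.equiv 2 _).injective
      simp
    rw [h5] at h4
    have h6 := h4.unique h2
    rw [hR, hD]
    rw [neg_one_smul] at h6
    exact h6.symm
  · have e1 := fst_smul_timeQuotient hf hf0 hz
    have e2 := fst_smul_timeQuotient hf hf0 hRz
    rw [heven, ← e1] at e2
    have e3 : (timeReflection d z).fst = -z.fst := rfl
    rw [e3, neg_smul, ← smul_neg] at e2
    rw [← smul_right_injective ℂ hz0 e2, neg_neg]

theorem PolyharmonicOn.timeQuotient {N : ℕ} {c : ℝ} {f : TimeSpace d → ℂ}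
    (hf : PolyharmonicOn (N + 1) f (strip d (-c) c))
    (hf0 : ∀ y : EuclideanSpace ℝ (Fin d), f (TimeSpace.mk 0 y) = 0)
    (heven : ∀ z, f (timeReflection d z) = f z) :
    PolyharmonicOn N (timeQuotient f) (strip d (-c) c) := by
  set V := strip d (-c) c with hVdef
  have hV : IsOpen V := isOpen_strip d (-c) c
  have hfa := hf.analyticOnNhd (Nat.succ_pos N) hV
  have hH := analyticOnNhd_timeQuotient (Nat.succ_pos N) hf hf0
  set H := _root_.timeQuotient f with hHdef
  refine ⟨fun z hz ↦ (hH z hz).contDiffAt.contDiffWithinAt, ?_⟩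
  set g : TimeSpace d → ℂ := Δ^[N] H with hgdef
  have hg : AnalyticOnNhd ℝ g V := hH.laplacian_iterate N
  have htH : EqOn (fun z ↦ ⟪timeBasis d (Sum.inl ()), z⟫ • H z) f V := by
    intro z hz
    simp only [inner_timeBasis_inl]
    exact fst_smul_timeQuotient hfa hf0 hz
  -- Apply `Δ^(N+1)` to `t H = f`.
  have hpde : ∀ z ∈ V, ⟪timeBasis d (Sum.inl ()), z⟫ • Δ g z +
      (2 * ((N : ℝ) + 1)) • dirDeriv (timeBasis d (Sum.inl ())) g z = 0 := by
    intro z hz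
    have h1 := iterate_laplacian_inner_smul (timeBasis d) (Sum.inl ()) hV hH N hz
    rw [htH.iterate_laplacian hV (N + 1) hz, hf.2 z hz] at h1
    simp only [Function.iterate_succ_apply'] at h1
    exact h1.symm
  have hg0 : ∀ z ∈ V, ⟪timeBasis d (Sum.inl ()), z⟫ = 0 → g z = 0 := by
    intro z hz hz0
    rw [inner_timeBasis_inl] at hz0
    have hR : timeReflection d z = z := by
      have e : z = TimeSpace.mk z.fst z.snd := rfl
      rw [e, timeReflection_mk, hz0, neg_zero]
    -- The reflection is an isometry, so `Δ^N` preserves oddness; at its fixed points `g z = -g z`.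
    have hodd : EqOn (fun z ↦ H (0 + timeReflection d z)) (-H) V := by
      intro w hw
      simp only [zero_add, Pi.neg_apply]
      exact timeQuotient_timeReflection hfa hf0 heven hw
    have h1 := hodd.iterate_laplacian hV N hz
    rw [iterate_laplacian_comp_add_isometry, iterate_laplacian_neg] at h1
    simp only [zero_add, hR, Pi.neg_apply] at h1
    exact self_eq_neg.1 h1
  have hVadd : ∀ z ∈ V, ∀ v, ⟪timeBasis d (Sum.inl ()), v⟫ = 0 → z + v ∈ V := by
    intro z hz v hv
    rw [inner_timeBasis_inl] at hv
    change z.fst + v.fst ∈ Ioo (-c) c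
    rw [hv, add_zero]
    exact hz
  have hder := iterate_dirDeriv_eq_zero (timeBasis d) (Sum.inl ()) hV hVadd hg
    (c := 2 * ((N : ℝ) + 1)) (by positivity) hpde hg0
  intro z hz
  have hc : 0 < c := by
    have : -c < c := hz.1.trans hz.2
    linarith
  have hdec : ∀ s : ℝ, TimeSpace.mk 0 z.snd + s • timeBasis d (Sum.inl ()) =
      TimeSpace.mk s z.snd := by
    intro s
    rw [timeBasis_inl]
    apply (WithLp.equiv 2 _).injective
    simp
  have key := eq_zero_of_iterate_dirDeriv_eq_zero hg (z := TimeSpace.mk 0 z.snd)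
    (v := timeBasis d (Sum.inl ())) (isOpen_Ioo (a := -c) (b := c)) isPreconnected_Ioo
    ⟨neg_lt_zero.2 hc, hc⟩ (fun s hs ↦ by rw [hdec]; exact hs)
    (fun k ↦ hder k _ ⟨neg_lt_zero.2 hc, hc⟩ (by rw [inner_timeBasis_inl]; rfl)) hz
  rw [hdec] at key
  exact key

theorem PolyharmonicOn.comp_add_isometry {E : Type*} [NormedAddCommGroup E]
    [InnerProductSpace ℝ E] [FiniteDimensional ℝ E] {N : ℕ} {u : E → ℂ} {U V : Set E}
    (hu : PolyharmonicOn N u U) (p : E) (A : E ≃ₗᵢ[ℝ] E) (hVU : ∀ z ∈ V, p + A z ∈ U) :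
    PolyharmonicOn N (fun z ↦ u (p + A z)) V := by
  refine ⟨hu.1.comp (contDiff_const.add A.contDiff).contDiffOn hVU, fun z hz ↦ ?_⟩
  rw [iterate_laplacian_comp_add_isometry]
  exact hu.2 _ (hVU z hz)

theorem PolyharmonicOn.add {E : Type} [NormedAddCommGroup E] [InnerProductSpace ℝ E]
    [FiniteDimensional ℝ E] {N : ℕ} (hN : 1 ≤ N) {f g : E → ℂ} {U : Set E} (hU : IsOpen U)
    (hf : PolyharmonicOn N f U) (hg : PolyharmonicOn N g U) : PolyharmonicOn N (f + g) U := by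
  refine ⟨hf.1.add hg.1, fun z hz ↦ ?_⟩
  rw [iterate_laplacian_add hU (hf.analyticOnNhd hN hU) (hg.analyticOnNhd hN hU) N hz,
    Pi.add_apply, hf.2 z hz, hg.2 z hz, add_zero]

end Strip

/-! ### Symmetrization about `t₀` and conclusion -/

theorem mainTheorem6 (d N : ℕ) (hN : 1 ≤ N) (a b t₀ c : ℝ) (ht₀ : t₀ ∈ Set.Ioo a b)
    (hc : c = min (b - t₀) (t₀ - a)) (u : TimeSpace d → ℂ)
    (hu : PolyharmonicOn N u (strip d a b))
    (hu₀ : ∀ y : EuclideanSpace ℝ (Fin d), u (TimeSpace.mk t₀ y) = 0) :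
    ∃ H : TimeSpace d → ℂ,
      PolyharmonicOn (N - 1) H (strip d (-c) c) ∧
      IsOddAt (-c) c 0 H ∧
      ∀ t ∈ Set.Ioo (-c) c, ∀ y : EuclideanSpace ℝ (Fin d),
        u (TimeSpace.mk (t₀ + t) y) + u (TimeSpace.mk (t₀ - t) y)
          = (t : ℂ) * H (TimeSpace.mk t y) := by
  obtain ⟨k, rfl⟩ : ∃ k, N = k + 1 := ⟨N - 1, by omega⟩
  have hV := isOpen_strip d (-c) c
  have hcb : c ≤ b - t₀ := hc.trans_le (min_le_left _ _)
  have hca : c ≤ t₀ - a := hc.trans_le (min_le_right _ _)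
  let p : TimeSpace d := TimeSpace.mk t₀ 0
  -- The identity isometry is inserted so that translation and reflection are handled by the same
  -- composition lemma.
  let f₁ : TimeSpace d → ℂ := fun z ↦ u (p + LinearIsometryEquiv.refl ℝ (TimeSpace d) z)
  let f₂ : TimeSpace d → ℂ := fun z ↦ u (p + timeReflection d z)
  have hf₁ : PolyharmonicOn (k + 1) f₁ (strip d (-c) c) := by
    refine hu.comp_add_isometry p _ fun z hz ↦ ?_
    change t₀ + z.fst ∈ Ioo a b
    constructor <;> linarith [hz.1, hz.2]
  have hf₂ : PolyharmonicOn (k + 1) f₂ (strip d (-c) c) := by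
    refine hu.comp_add_isometry p _ fun z hz ↦ ?_
    change t₀ + -z.fst ∈ Ioo a b
    constructor <;> linarith [hz.1, hz.2]
  have hf := hf₁.add hN hV hf₂
  have hmk : ∀ (t : ℝ) (y : EuclideanSpace ℝ (Fin d)), (f₁ + f₂) (TimeSpace.mk t y) =
      u (TimeSpace.mk (t₀ + t) y) + u (TimeSpace.mk (t₀ - t) y) := by
    intro t y
    have e : ∀ s : ℝ, p + TimeSpace.mk s y = TimeSpace.mk (t₀ + s) y := by
      intro s
      apply (WithLp.equiv 2 _).injective
      simp [p]
    simp only [f₁, f₂, Pi.add_apply, LinearIsometryEquiv.coe_refl, id_eq, timeReflection_mk, e,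
      sub_eq_add_neg]
  have hf0 : ∀ y : EuclideanSpace ℝ (Fin d), (f₁ + f₂) (TimeSpace.mk 0 y) = 0 := by
    intro y
    rw [hmk, add_zero, sub_zero, hu₀, add_zero]
  have heven : ∀ z, (f₁ + f₂) (timeReflection d z) = (f₁ + f₂) z := by
    intro z
    have e : z = TimeSpace.mk z.fst z.snd := rfl
    rw [e, timeReflection_mk, hmk, hmk, sub_neg_eq_add, ← sub_eq_add_neg, add_comm]
  have hfa := hf.analyticOnNhd hN hV
  refine ⟨timeQuotient (f₁ + f₂), hf.timeQuotient hf0 heven, ?_, ?_⟩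
  · intro t ht y
    rw [sub_zero, sub_neg_eq_add, zero_add, min_self, abs_lt] at ht
    have hz : (TimeSpace.mk t y : TimeSpace d) ∈ strip d (-c) c := ht
    rw [zero_add, zero_sub, ← timeReflection_mk,
      timeQuotient_timeReflection hfa hf0 heven hz, neg_neg]
  · intro t ht y
    rw [← hmk, ← fst_smul_timeQuotient hfa hf0 (z := TimeSpace.mk t y) ht, Complex.real_smul]
    rfl
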